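/- Let $0<R<\infty$, $0<T<\infty$, $\lambda>0$, $\alpha\ge 0$, $0<\zeta\le\eta\le 1$ with $\zeta+\eta\le 1$, and let the collision kernel be $$K(m,n)=\begin{cases}\lambda mn, & m<1,\ n<1,\\ \lambda m n^{-\alpha}, & m<1,\ n\ge 1,\\ \lambda m^{-\alpha}n, & m\ge 1,\ n<1,\\ \lambda(m^{\zeta}n^{\eta}+m^{\eta}n^{\zeta}), & m\ge 1,\ n\ge 1.\end{cases}$$ Let $B(m,n,z)\ge 0$ be a measurable breakage function, bounded on $(0,R)^3$, with supremum norm $\|B\|_\infty=\sup_{(0,R)^3}|B|$, with $B(m,n,z)=0$ for $m>n$ and $\int_0^n m\,B(m,n,z)\,dm\le n$ for all $n,z\in(0,R)$. Let $C^{in}\in L^1(0,R)$, $C^{in}\ge 0$ a.e., and put $M_1^{in}=\int_0^R m\,C^{in}(m)\,dm$ and $$S(T,R)=\lambda\bigl(2R\,\|C^{in}\|_{L^1(0,R)}\,e^{2\lambda R\|B\|_\infty M_1^{in}T}+M_1^{in}\bigr).$$ For a partition $0=m_{1/2}<m_{3/2}<\dots<m_{I+1/2}=R$ with cells $\Lambda_a=(m_{a-1/2},m_{a+1/2}]$,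 widths $\Delta m_a$, midpoints $m_a$ and mesh size $h=\max_a\Delta m_a$, and for $\Delta t=T/N$, $N\ge 1$, define $C_a^0=\frac1{\Delta m_a}\int_{\Lambda_a}C^{in}\,dm$ and, for $n\ge 0$, $$C_a^{n+1}=C_a^n+\frac{\Delta t}{\Delta m_a}\sum_{l=1}^{I}\sum_{j=a}^{I}K_{j,l}C_j^nC_l^n\Delta m_j\Delta m_l\int_{m_{a-1/2}}^{p_j^a}B(m,m_j,m_l)\,dm-\Delta t\sum_{j=1}^{I}K_{a,j}C_a^nC_j^n\Delta m_j,$$ where $p_a^a=m_a$, $p_j^a=m_{a+1/2}$ for $j\ne a$, and $K_{a,j}=\frac{1}{\Delta m_a\Delta m_j}\int_{\Lambda_j}\int_{\Lambda_a}K(u,v)\,du\,dv$. Let $$C^h(t,m)=\sum_{n=0}^{N-1}\sum_{a=1}^{I}C_a^n\,\chi_{\Lambda_a}(m)\,\chi_{[n\Delta t,(n+1)\Delta t)}(t).$$ Call $\psi:[0,\infty)\to[0,\infty)$ a de la Vallée Poussin function if it is convex and $C^1$, $\psi(0)=0$, $\psi'(0)=1$, $\psi'$ is concave, $\psi'(\nu)\to\infty$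 and $\psi(\nu)/\nu\to\infty$ as $\nu\to\infty$, and $\sup_{\nu\ge 1}\psi(\nu)/\nu^{\sigma}<\infty$ for every $\sigma\in(1,2)$. **Proposition.** There is a de la Vallée Poussin function $\psi$ with $\int_0^R\psi(C^{in})\,dm<\infty$. Moreover, let $0<\theta<1$. Then there is $h_0>0$ such that the family $\mathcal F$ of all $C^h$ with $h\le h_0$ and $S(T,R)\,\Delta t\le\theta$ has the following properties. 1. Every $C^h\in\mathcal F$ is nonnegative. 2. For every de la Vallée Poussin function $\psi$ with $\int_0^R\psi(C^{in})\,dm<\infty$ one has $$\sup_{C^h\in\mathcal F}\ \int_0^T\!\!\int_0^R\psi\bigl(C^h(t,m)\bigr)\,dm\,dt<\infty .$$ 3. $\mathcal F$ is (relatively) weakly sequentially compact in $L^1((0,T)\times(0,R))$: its members are integrable, and every sequence in $\mathcal F$ has a subsequence $(f_k)$ for which there is $f\in L^1((0,T)\times(0,R))$ with $\int\!\!\int f_k\,g\to\int\!\!\int f\,g$ for all $g\in L^\infty((0,T)\times(0,R))$. -/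

import Mathlib

open MeasureTheory Set Filter Topology
open scoped ENNReal NNReal

noncomputable section

namespace CollisionalBreakage

/-- The collision kernel. The lines `m = 1` and `n = 1` are null sets and do not influence the cell
averages that enter the scheme. -/
def collisionKernel (lam α ζ η : ℝ) (m n : ℝ) : ℝ :=
  if m < 1 then
    if n < 1 then lam * (m * n) else lam * (m * n ^ (-α))
  else
    if n < 1 then lam * (m ^ (-α) * n) else lam * (m ^ ζ * n ^ η + m ^ η * n ^ ζ)

/-- A bounded breakage distribution function on `]0,R[`: `B m n z` is the rate of production of
particles of volume `m` from a particle of volume `n` hit by a particle of volume `z`.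
It is a genuine function (the scheme evaluates it at grid points). The total volume of the
fragments of a particle of volume `n` is at most `n`; exact equality for all small `n` would
contradict boundedness. -/
structure IsBreakageKernel (R : ℝ) (B : ℝ → ℝ → ℝ → ℝ) : Prop where
  measurable : Measurable fun p : ℝ × ℝ × ℝ => B p.1 p.2.1 p.2.2
  nonneg : ∀ m ∈ Ioo 0 R, ∀ n ∈ Ioo 0 R, ∀ z ∈ Ioo 0 R, 0 ≤ B m n z
  bounded : BddAbove
    ((fun p : ℝ × ℝ × ℝ => |B p.1 p.2.1 p.2.2|) '' (Ioo 0 R ×ˢ Ioo 0 R ×ˢ Ioo 0 R))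
  support : ∀ m ∈ Ioo 0 R, ∀ n ∈ Ioo 0 R, ∀ z ∈ Ioo 0 R, n < m → B m n z = 0
  mass_le : ∀ n ∈ Ioo 0 R, ∀ z ∈ Ioo 0 R, ∫ m in Ioo 0 n, m * B m n z ≤ n

/-- The supremum norm of `B` on `]0,R[³`. -/
def supNorm (R : ℝ) (B : ℝ → ℝ → ℝ → ℝ) : ℝ :=
  sSup ((fun p : ℝ × ℝ × ℝ => |B p.1 p.2.1 p.2.2|) '' (Ioo 0 R ×ˢ Ioo 0 R ×ˢ Ioo 0 R))

/-- The `L¹(]0,R[)` norm of the initial datum. -/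
def initialNorm (R : ℝ) (Cin : ℝ → ℝ) : ℝ := ∫ m in Ioo 0 R, |Cin m|

/-- The first moment of the initial datum on `]0,R[`. -/
def initialMass (R : ℝ) (Cin : ℝ → ℝ) : ℝ := ∫ m in Ioo 0 R, m * Cin m

/-- The constant `S(T,R)` of the stability condition `S(T,R) Δt ≤ θ`. -/
def stabilityConst (lam T R : ℝ) (B : ℝ → ℝ → ℝ → ℝ) (Cin : ℝ → ℝ) : ℝ :=
  lam * (2 * R * initialNorm R Cin *
      Real.exp (2 * lam * R * supNorm R B * initialMass R Cin * T) + initialMass R Cin)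

/-- A partition of `]0,R]` into the `cells` half-open intervals `]node a, node (a+1)]`,
`a = 0, …, cells - 1`. The values of `node` beyond index `cells` are never used. -/
structure Mesh (R : ℝ) where
  cells : ℕ
  node : ℕ → ℝ
  node_zero : node 0 = 0
  node_last : node cells = R
  node_lt : ∀ a < cells, node a < node (a + 1)

namespace Mesh

variable {R : ℝ} (M : Mesh R)

/-- The width of the cell `a`. -/
def width (a : ℕ) : ℝ := M.node (a + 1) - M.node a

/-- The midpoint of the cell `a`. -/
def mid (a : ℕ) : ℝ := (M.node a + M.node (a + 1)) / 2

/-- The cell `]node a, node (a+1)]`. -/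
def cell (a : ℕ) : Set ℝ := Ioc (M.node a) (M.node (a + 1))

/-- The mesh size: the largest width of a cell. -/
def size : ℝ := ⨆ a : Fin M.cells, M.width a

/-- The upper limit of integration in the birth term of cell `a`. -/
def upper (a j : ℕ) : ℝ := if j = a then M.mid a else M.node (a + 1)

/-- The average of the kernel `K` over the product of the cells `a` and `j`. -/
def kernelAvg (K : ℝ → ℝ → ℝ) (a j : ℕ) : ℝ :=
  1 / (M.width a * M.width j) * (∫ v in M.cell j, ∫ u in M.cell a, K u v)

/-- The explicit Euler finite volume scheme with time step `dt`: `conc K B Cin dt n a` is the value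
at the `n`-th time level in the cell `a`. -/
def conc (K : ℝ → ℝ → ℝ) (B : ℝ → ℝ → ℝ → ℝ) (Cin : ℝ → ℝ) (dt : ℝ) : ℕ → ℕ → ℝ
  | 0, a => 1 / M.width a * (∫ m in M.cell a, Cin m)
  | n + 1, a =>
      conc K B Cin dt n a
        + dt / M.width a * (∑ l ∈ Finset.range M.cells, ∑ j ∈ Finset.Ico a M.cells,
            M.kernelAvg K j l * conc K B Cin dt n j * conc K B Cin dt n l
              * M.width j * M.width l
              * (∫ m in Ioc (M.node a) (M.upper a j), B m (M.mid j) (M.mid l)))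
        - dt * (∑ j ∈ Finset.range M.cells,
            M.kernelAvg K a j * conc K B Cin dt n a * conc K B Cin dt n j * M.width j)

/-- The piecewise constant approximation on `[0,T[ × ]0,R]` with `N` time steps of length `T / N`,
as a function of `(t, m)`. -/
def approx (K : ℝ → ℝ → ℝ) (B : ℝ → ℝ → ℝ → ℝ) (Cin : ℝ → ℝ) (T : ℝ) (N : ℕ) (p : ℝ × ℝ) : ℝ :=
  ∑ n ∈ Finset.range N, ∑ a ∈ Finset.range M.cells,
    M.conc K B Cin (T / N) n a * (M.cell a).indicator 1 p.2
      * (Ico (n * (T / N)) ((n + 1) * (T / N))).indicator 1 p.1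

end Mesh

/-- The family of all approximations produced by meshes of size at most `h₀` and time steps
`Δt = T / N` with `S(T,R) Δt ≤ θ`. -/
def approxFamily (lam α ζ η T R θ h₀ : ℝ) (B : ℝ → ℝ → ℝ → ℝ) (Cin : ℝ → ℝ) : Set (ℝ × ℝ → ℝ) :=
  {f | ∃ (M : Mesh R) (N : ℕ), 0 < N ∧ M.size ≤ h₀ ∧
    stabilityConst lam T R B Cin * (T / N) ≤ θ ∧
    f = M.approx (collisionKernel lam α ζ η) B Cin T N}

/-- The de la Vallée Poussin functions. -/
structure IsVallee (ψ : ℝ → ℝ) : Prop where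
  convex : ConvexOn ℝ (Ici 0) ψ
  nonneg : ∀ ν ∈ Ici (0 : ℝ), 0 ≤ ψ ν
  contDiff : ContDiffOn ℝ 1 ψ (Ici 0)
  zero : ψ 0 = 0
  deriv_zero : derivWithin ψ (Ici 0) 0 = 1
  deriv_concave : ConcaveOn ℝ (Ici 0) (derivWithin ψ (Ici 0))
  deriv_tendsto : Tendsto (derivWithin ψ (Ici 0)) atTop atTop
  superlinear : Tendsto (fun ν => ψ ν / ν) atTop atTop
  growth : ∀ θ ∈ Ioo (1 : ℝ) 2, BddAbove ((fun ν : ℝ => ψ ν / ν ^ θ) '' Ici 1)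

/-- Relative weak sequential compactness in `L¹(μ)` of a set of functions: all members are
integrable, and each sequence of members has a subsequence that converges weakly (tested against
`L^∞(μ)`) to an integrable function. -/
def IsWeaklySeqCompactL1 {X : Type*} [MeasurableSpace X] (μ : Measure X) (F : Set (X → ℝ)) : Prop :=
  (∀ f ∈ F, Integrable f μ) ∧
  ∀ u : ℕ → X → ℝ, (∀ k, u k ∈ F) →
    ∃ φ : ℕ → ℕ, StrictMono φ ∧ ∃ f : X → ℝ, Integrable f μ ∧
      ∀ g : X → ℝ, MemLp g ∞ μ →
        Tendsto (fun k => ∫ x, u (φ k) x * g x ∂μ) atTop (𝓝 (∫ x, f x * g x ∂μ))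

end CollisionalBreakage

end

/-! Everything rests on one pointwise estimate: on fine meshes satisfying the stability condition,
`0 ≤ C_a^n ≤ C_a^0 + G`, with `G` independent of mesh and time step (`exists_conc_bounds`). Since `ζ
+ η ≤ 1`, the collision kernel is at most `λ(u + v)` (`collisionKernel_le`), so the collision rate
is at most `2λ` times number times mass. As `B` is bounded, the birth term raises the density of
each cell by at most `‖B‖` times this rate, and a bound on number and mass suffices. Mass would not
increase but for the evaluation at midpoints, whose excess is of the order of the mesh size; number
then grows at most exponentially. The factor 2 in `S(T,R)` absorbs the excess, so that no cell loses
more than its content in one step.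

The entropy bound follows because `ψ(x + y) ≤ 2ψ(x) + 2ψ(y)` (`IsVallee.apply_add_le`), while
Jensen's inequality controls the cell averages of the initial datum by `∫ ψ(C^in)`
(`IsVallee.sum_conc_zero_le`). Some admissible `ψ` exists by the refined de la Vallée Poussin
theorem (`exists_isVallee`). Its superlinearity turns the entropy bound into uniform integrability,
and the Dunford–Pettis theorem (`exists_subseq_weak_L1`) yields compactness. -/

namespace CollisionalBreakage

/-! ### Weak sequential compactness in `L¹`. -/

/-- Diagonal form of the sequential Banach–Alaoglu theorem in `L²`: countably many bounded
sequences have a common weakly convergent subsequence. -/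
theorem exists_subseq_weak_L2 {X : Type*} [MeasurableSpace X]
    [MeasurableSpace.CountablyGenerated X] {μ : Measure X} [IsFiniteMeasure μ]
    (v : ℕ → ℕ → X → ℝ) (hv : ∀ K k, AEStronglyMeasurable (v K k) μ) (c : ℕ → ℝ)
    (hc : ∀ K k x, ‖v K k x‖ ≤ c K) :
    ∃ φ : ℕ → ℕ, StrictMono φ ∧ ∃ w : ℕ → X → ℝ, (∀ K, MemLp (w K) 2 μ) ∧
      ∀ K, ∀ g : X → ℝ, MemLp g 2 μ →
        Tendsto (fun k => ∫ x, v K (φ k) x * g x ∂μ) atTop (𝓝 (∫ x, w K x * g x ∂μ)) := by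
  -- Together with the countably generated σ-algebra, this makes `L²` separable, which the
  -- metrizability below requires.
  have : Fact ((2 : ℝ≥0∞) ≠ ∞) := ⟨by norm_num⟩
  have hmem : ∀ K k, MemLp (v K k) 2 μ := fun K k =>
    MemLp.of_bound (hv K k) (c K) (Eventually.of_forall (hc K k))
  let E := Lp ℝ 2 μ
  let r : ℕ → ℝ := fun K => (measureUnivNNReal μ : ℝ) ^ ((2 : ℝ≥0∞).toReal⁻¹) * max (c K) 0
  let S : ℕ → Set (WeakDual ℝ E) := fun K =>
    WeakDual.toStrongDual ⁻¹' Metric.closedBall (0 : StrongDual ℝ E) (r K)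
  have hS : ∀ K, IsCompact (S K) := fun K => WeakDual.isCompact_closedBall 0 (r K)
  have : ∀ K, CompactSpace (S K) := fun K => isCompact_iff_compactSpace.mp (hS K)
  have : ∀ K, TopologicalSpace.MetrizableSpace (S K) := fun K =>
    WeakDual.metrizable_of_isCompact ℝ E (S K) (hS K)
  let F : ℕ → ℕ → WeakDual ℝ E := fun K k =>
    StrongDual.toWeakDual (InnerProductSpace.toDual ℝ E ((hmem K k).toLp _))
  have hF : ∀ K k, F K k ∈ S K := by
    intro K k
    have h1 : ‖InnerProductSpace.toDual ℝ E ((hmem K k).toLp _)‖ ≤ r K := by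
      rw [LinearIsometryEquiv.norm_map]
      refine Lp.norm_le_of_ae_bound (le_max_right _ _) ?_
      filter_upwards [(hmem K k).coeFn_toLp] with x hx
      rw [hx]
      exact (hc K k x).trans (le_max_left _ _)
    exact mem_closedBall_zero_iff.mpr h1
  -- The countable product of compact metrizable balls is compact and metrizable, hence sequentially
  -- compact; this replaces a diagonal extraction.
  obtain ⟨a, φ, hφ, hlim⟩ := CompactSpace.tendsto_subseq
    (fun k : ℕ => fun K : ℕ => (⟨F K k, hF K k⟩ : S K))
  refine ⟨φ, hφ, fun K => (InnerProductSpace.toDual ℝ E).symm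
    (WeakDual.toStrongDual (a K : WeakDual ℝ E)), fun K => Lp.memLp _, ?_⟩
  intro K g hg
  have h1 := ((tendsto_pi_nhds.mp hlim) K)
  have h2 := (continuous_subtype_val.tendsto _).comp h1
  have h3 := ((WeakDual.eval_continuous (hg.toLp g : E)).tendsto _).comp h2
  have e1 : ∀ k, (F K k) (hg.toLp g : E) = ∫ x, v K k x * g x ∂μ := by
    intro k
    have : (F K k) (hg.toLp g : E) = inner ℝ ((hmem K k).toLp _) (hg.toLp g) :=
      InnerProductSpace.toDual_apply_apply
    rw [this, L2.inner_def]
    refine integral_congr_ae ?_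
    filter_upwards [(hmem K k).coeFn_toLp, hg.coeFn_toLp] with x hx hx'
    rw [hx, hx']
    simp [mul_comm]
  have e2 : (a K : WeakDual ℝ E) (hg.toLp g : E)
      = ∫ x, ((InnerProductSpace.toDual ℝ E).symm
        (WeakDual.toStrongDual (a K : WeakDual ℝ E))) x * g x ∂μ := by
    have : (a K : WeakDual ℝ E) (hg.toLp g : E) = inner ℝ ((InnerProductSpace.toDual ℝ E).symm
        (WeakDual.toStrongDual (a K : WeakDual ℝ E))) (hg.toLp g) := by
      rw [InnerProductSpace.toDual_symm_apply]; rfl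
    rw [this, L2.inner_def]
    refine integral_congr_ae ?_
    filter_upwards [hg.coeFn_toLp] with x hx'
    rw [hx']
    simp [mul_comm]
  rw [← e2]
  refine h3.congr fun k => ?_
  simpa using e1 (φ k)

/-- Sequential half of the Dunford–Pettis theorem: a uniformly integrable sequence of nonnegative
functions has a subsequence that converges weakly in `L¹`. -/
theorem exists_subseq_weak_L1 {X : Type*} [MeasurableSpace X]
    [MeasurableSpace.CountablyGenerated X] {μ : Measure X} [IsFiniteMeasure μ]
    (u : ℕ → X → ℝ) (hu : ∀ k, Integrable (u k) μ) (hu0 : ∀ k x, 0 ≤ u k x)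
    (hui : ∀ ε > 0, ∃ K₀ : ℕ, ∀ K ≥ K₀, ∀ k, ∫ x, (u k x - min (u k x) (K : ℝ)) ∂μ ≤ ε) :
    ∃ φ : ℕ → ℕ, StrictMono φ ∧ ∃ f : X → ℝ, Integrable f μ ∧
      ∀ g : X → ℝ, MemLp g ∞ μ →
        Tendsto (fun k => ∫ x, u (φ k) x * g x ∂μ) atTop (𝓝 (∫ x, f x * g x ∂μ)) := by
  let v : ℕ → ℕ → X → ℝ := fun K k x => min (u k x) (K : ℝ)
  have hv : ∀ K k, AEStronglyMeasurable (v K k) μ := fun K k =>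
    (hu k).aestronglyMeasurable.inf aestronglyMeasurable_const
  have hvb : ∀ K k x, ‖v K k x‖ ≤ (K : ℝ) := fun K k x => by
    rw [Real.norm_of_nonneg (le_min (hu0 k x) (Nat.cast_nonneg K))]
    exact min_le_right _ _
  have hvi : ∀ K k, Integrable (v K k) μ := fun K k =>
    (MemLp.of_bound (p := 1) (hv K k) K (Eventually.of_forall (hvb K k))).integrable le_rfl
  obtain ⟨φ, hφ, w, hw, hlim⟩ := exists_subseq_weak_L2 (μ := μ) v hv (fun K => (K : ℝ)) hvb
  have hwi : ∀ K, Integrable (w K) μ := fun K => (hw K).integrable (by norm_num)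
  -- The weak limits `w K` of the truncations are strongly Cauchy in `L¹`. Testing `w K' - w K`
  -- against its own sign gives its norm as a limit of integrals, each controlled through `0 ≤ v K'
  -- - v K ≤ u - v K`.
  have hdist : ∀ K K' : ℕ, K ≤ K' → ∀ ε, (∀ k, ∫ x, (u k x - v K k x) ∂μ ≤ ε) →
      ∫ x, |w K' x - w K x| ∂μ ≤ ε := by
    intro K K' hKK ε hε
    let m : X → ℝ := fun x => (SignType.sign (w K' x - w K x) : ℝ)
    have hm1 : ∀ x, ‖m x‖ ≤ 1 := by
      intro x
      show ‖((SignType.sign (w K' x - w K x) : SignType) : ℝ)‖ ≤ 1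
      rcases SignType.sign (w K' x - w K x) with _ | _ | _ <;> simp
    have hmm : AEStronglyMeasurable m μ := by
      have hsm : Measurable fun y : ℝ => ((SignType.sign y : SignType) : ℝ) := by
        have : (fun y : ℝ => ((SignType.sign y : SignType) : ℝ))
            = fun y => if 0 < y then 1 else if y < 0 then -1 else 0 := by
          funext y
          rw [sign_apply]
          split_ifs <;> simp
        rw [this]
        exact Measurable.ite measurableSet_Ioi measurable_const
          (Measurable.ite measurableSet_Iio measurable_const measurable_const)
      exact (hsm.comp_aemeasurable
        ((hwi K').aemeasurable.sub (hwi K).aemeasurable)).aestronglyMeasurable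
    have hm2 : MemLp m 2 μ := MemLp.of_bound hmm 1 (Eventually.of_forall hm1)
    have hi : ∀ {f : X → ℝ}, Integrable f μ → Integrable (fun x => f x * m x) μ := fun hf => by
      simpa only [mul_comm] using hf.bdd_mul hmm (Eventually.of_forall hm1)
    have ht := (hlim K' m hm2).sub (hlim K m hm2)
    have e : ∫ x, |w K' x - w K x| ∂μ = ∫ x, w K' x * m x ∂μ - ∫ x, w K x * m x ∂μ := by
      rw [← integral_sub (hi (hwi K')) (hi (hwi K))]
      refine integral_congr_ae (Eventually.of_forall fun x => ?_)
      show |w K' x - w K x| = w K' x * m x - w K x * m x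
      rw [← sub_mul, mul_comm, sign_mul_self]
    rw [e]
    refine le_of_tendsto' ht fun k => ?_
    rw [← integral_sub (hi (hvi K' _)) (hi (hvi K _))]
    refine le_trans (integral_mono ((hi (hvi K' _)).sub (hi (hvi K _)))
      ((hu _).sub (hvi K _)) fun x => ?_) (hε (φ k))
    have h1 : v K (φ k) x ≤ v K' (φ k) x :=
      min_le_min le_rfl (Nat.cast_le.mpr hKK)
    have h2 : v K' (φ k) x ≤ u (φ k) x := min_le_left _ _
    have h3 := (le_abs_self _).trans (hm1 x)
    show v K' (φ k) x * m x - v K (φ k) x * m x ≤ u (φ k) x - v K (φ k) x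
    nlinarith
  let W : ℕ → Lp ℝ 1 μ := fun K => (hwi K).toL1 (w K)
  have hW : ∀ K, (W K : X → ℝ) =ᵐ[μ] w K := fun K => (hwi K).coeFn_toL1
  have hcau : CauchySeq W := by
    refine Metric.cauchySeq_iff'.mpr fun ε hε => ?_
    obtain ⟨K, hK⟩ := hui (ε / 2) (half_pos hε)
    refine ⟨K, fun K' hK' => lt_of_le_of_lt ?_ (half_lt_self hε)⟩
    rw [L1.dist_eq_integral_dist]
    refine le_trans (le_of_eq ?_) (hdist K K' hK' _ (hK K le_rfl))
    refine integral_congr_ae ?_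
    filter_upwards [hW K, hW K'] with x h1 h2
    rw [h1, h2, Real.dist_eq]
  obtain ⟨f, hf⟩ := cauchySeq_tendsto_of_complete hcau
  have hfi : Integrable f μ := L1.integrable_coeFn f
  refine ⟨φ, hφ, f, hfi, fun g hg => ?_⟩
  obtain ⟨C, hC0, hC⟩ : ∃ C : ℝ, 0 < C ∧ ∀ᵐ x ∂μ, ‖g x‖ ≤ C := by
    have hfin : eLpNormEssSup g μ < ∞ := by simpa using hg.2
    refine ⟨(eLpNormEssSup g μ).toReal + 1, by positivity, ?_⟩
    filter_upwards [ae_le_eLpNormEssSup (f := g) (μ := μ)] with x hx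
    have := ENNReal.toReal_mono hfin.ne hx
    rw [toReal_enorm] at this
    linarith
  have hg2 : MemLp g 2 μ := hg.mono_exponent le_top
  have hi : ∀ {f : X → ℝ}, Integrable f μ → Integrable (fun x => f x * g x) μ := fun hf => by
    simpa only [mul_comm] using hf.bdd_mul hg.1 hC
  have hbd : ∀ {f h : X → ℝ}, Integrable f μ → Integrable h μ →
      |∫ x, f x * g x ∂μ - ∫ x, h x * g x ∂μ| ≤ C * ∫ x, |f x - h x| ∂μ := by
    intro f h hf hh
    rw [← integral_sub (hi hf) (hi hh), ← integral_const_mul]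
    refine (abs_integral_le_integral_abs).trans (integral_mono_ae
      ((hi hf).sub (hi hh)).abs ((hf.sub hh).abs.const_mul C) ?_)
    filter_upwards [hC] with x hx
    show |f x * g x - h x * g x| ≤ C * |f x - h x|
    rw [← sub_mul, abs_mul, mul_comm]
    exact mul_le_mul_of_nonneg_right hx (abs_nonneg _)
  -- Three errors of size `ε / 4`: truncation of `u`, uniformly in `k`; weak convergence at the
  -- fixed level `K`; and the distance from `w K` to `f`.
  refine Metric.tendsto_atTop.mpr fun ε hε => ?_
  obtain ⟨K₀, hK₀⟩ := hui (ε / (4 * C)) (by positivity)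
  obtain ⟨K₁, hK₁⟩ := Metric.tendsto_atTop.mp hf (ε / (4 * C)) (by positivity)
  let K := max K₀ K₁
  have b1 : ∀ k, |∫ x, u (φ k) x * g x ∂μ - ∫ x, v K (φ k) x * g x ∂μ| ≤ ε / 4 := by
    intro k
    refine (hbd (hu _) (hvi K _)).trans ?_
    have : ∫ x, |u (φ k) x - v K (φ k) x| ∂μ = ∫ x, (u (φ k) x - v K (φ k) x) ∂μ := by
      refine integral_congr_ae (Eventually.of_forall fun x => abs_of_nonneg ?_)
      exact sub_nonneg.mpr (min_le_left _ _)
    rw [this]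
    refine (mul_le_mul_of_nonneg_left (hK₀ K (le_max_left _ _) (φ k)) hC0.le).trans (le_of_eq ?_)
    field_simp
  have b3 : |∫ x, w K x * g x ∂μ - ∫ x, f x * g x ∂μ| ≤ ε / 4 := by
    refine (hbd (hwi K) hfi).trans ?_
    have h1 := (hK₁ K (le_max_right _ _)).le
    rw [L1.dist_eq_integral_dist] at h1
    have : ∫ x, |w K x - f x| ∂μ = ∫ x, dist (W K x) (f x) ∂μ := by
      refine integral_congr_ae ?_
      filter_upwards [hW K] with x h1
      rw [h1, Real.dist_eq]
    rw [this]
    refine (mul_le_mul_of_nonneg_left h1 hC0.le).trans (le_of_eq ?_)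
    field_simp
  obtain ⟨k₀, hk₀⟩ := Metric.tendsto_atTop.mp (hlim K g hg2) (ε / 4) (by positivity)
  refine ⟨k₀, fun k hk => ?_⟩
  have b2 := hk₀ k hk
  rw [Real.dist_eq] at b2 ⊢
  have b1 := b1 k
  rw [abs_le] at b1 b3
  rw [abs_lt] at b2 ⊢
  constructor <;> linarith [b1.1, b1.2, b2.1, b2.2, b3.1, b3.2]

/-! ### Construction of a de la Vallée Poussin function. -/

/-- The derivative `1 + ∑ₖ min(1, x / aₖ)` of the de la Vallée Poussin function that is attached
to a rapidly increasing sequence `a`. -/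
noncomputable def valleeDensity (a : ℕ → ℝ) (x : ℝ) : ℝ := 1 + ∑' k, min 1 (x / a k)

section valleeDensity

variable {a : ℕ → ℝ}

theorem summable_inv_of_two_pow_le (ha : ∀ k, 2 ^ k ≤ a k) : Summable fun k => (a k)⁻¹ := by
  refine Summable.of_nonneg_of_le (fun k => inv_nonneg.mpr ((by positivity : (0:ℝ) ≤ 2 ^ k).trans
    (ha k))) (fun k => ?_) (summable_geometric_two)
  rw [one_div, inv_pow]
  exact inv_anti₀ (by positivity) (ha k)

theorem pos_of_two_pow_le (ha : ∀ k, 2 ^ k ≤ a k) (k : ℕ) : 0 < a k :=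
  lt_of_lt_of_le (by positivity) (ha k)

theorem summable_min_one_div (ha : ∀ k, 2 ^ k ≤ a k) (x : ℝ) :
    Summable fun k => min 1 (x / a k) := by
  refine Summable.of_norm_bounded ((summable_inv_of_two_pow_le ha).mul_left |x|) fun k => ?_
  have hk := pos_of_two_pow_le ha k
  have e : |x| * (a k)⁻¹ = |x / a k| := by rw [abs_div, abs_of_pos hk]; rfl
  rw [e, Real.norm_eq_abs]
  rcases le_total 1 (x / a k) with h | h
  · rw [min_eq_left h, abs_one]; exact h.trans (le_abs_self _)
  · rw [min_eq_right h]

theorem monotone_valleeDensity (ha : ∀ k, 2 ^ k ≤ a k) : Monotone (valleeDensity a) := by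
  intro x y hxy
  refine add_le_add le_rfl ((summable_min_one_div ha x).tsum_le_tsum (fun k => ?_)
    (summable_min_one_div ha y))
  exact min_le_min le_rfl (div_le_div_of_nonneg_right hxy (pos_of_two_pow_le ha k).le)

theorem valleeDensity_zero : valleeDensity a 0 = 1 := by simp [valleeDensity]

theorem one_le_valleeDensity (ha : ∀ k, 2 ^ k ≤ a k) {x : ℝ} (hx : 0 ≤ x) :
    1 ≤ valleeDensity a x :=
  valleeDensity_zero (a := a) ▸ monotone_valleeDensity ha hx

/-- The density is Lipschitz with constant `∑ 1 / aₖ`. -/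
theorem continuous_valleeDensity (ha : ∀ k, 2 ^ k ≤ a k) : Continuous (valleeDensity a) := by
  refine (LipschitzWith.of_dist_le' (f := valleeDensity a) (K := ∑' k, (a k)⁻¹) fun x y => ?_).continuous
  have hs := summable_inv_of_two_pow_le ha
  rw [Real.dist_eq, Real.dist_eq, valleeDensity, valleeDensity, add_sub_add_left_eq_sub,
    ← (summable_min_one_div ha x).tsum_sub (summable_min_one_div ha y), ← tsum_mul_right]
  rw [← Real.norm_eq_abs]
  refine tsum_of_norm_bounded (hs.mul_right |x - y|).hasSum fun k => ?_
  have hk := pos_of_two_pow_le ha k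
  refine (abs_min_sub_min_le_max _ _ _ _).trans ?_
  rw [sub_self, abs_zero, max_eq_right (abs_nonneg _), ← sub_div, abs_div, abs_of_pos hk,
    div_eq_inv_mul]

/-- Each summand is a minimum of two affine functions. -/
theorem concaveOn_valleeDensity (ha : ∀ k, 2 ^ k ≤ a k) :
    ConcaveOn ℝ univ (valleeDensity a) := by
  refine ⟨convex_univ, fun x _ y _ s t hs ht hst => ?_⟩
  have hx := summable_min_one_div ha x
  have hy := summable_min_one_div ha y
  have hkey : s * ∑' k, min 1 (x / a k) + t * ∑' k, min 1 (y / a k)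
      ≤ ∑' k, min 1 ((s * x + t * y) / a k) := by
    rw [← tsum_mul_left, ← tsum_mul_left, ← (hx.mul_left s).tsum_add (hy.mul_left t)]
    refine ((hx.mul_left s).add (hy.mul_left t)).tsum_le_tsum (fun k => ?_)
      (summable_min_one_div ha _)
    refine le_min ?_ ?_
    · have h1 := mul_le_mul_of_nonneg_left (min_le_left 1 (x / a k)) hs
      have h2 := mul_le_mul_of_nonneg_left (min_le_left 1 (y / a k)) ht
      linarith
    · have h1 := mul_le_mul_of_nonneg_left (min_le_right 1 (x / a k)) hs
      have h2 := mul_le_mul_of_nonneg_left (min_le_right 1 (y / a k)) ht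
      calc _ ≤ s * (x / a k) + t * (y / a k) := add_le_add h1 h2
        _ = _ := by ring
  simp only [smul_eq_mul, valleeDensity]
  linarith

/-- Beyond `a₀ + ⋯ + aₙ₋₁` the first `n` summands all equal 1. -/
theorem tendsto_valleeDensity (ha : ∀ k, 2 ^ k ≤ a k) :
    Tendsto (valleeDensity a) atTop atTop := by
  refine tendsto_atTop.mpr fun b => ?_
  obtain ⟨n, hn⟩ := exists_nat_ge b
  filter_upwards [eventually_ge_atTop (∑ k ∈ Finset.range n, a k)] with x hx
  have hpos := fun k => pos_of_two_pow_le ha k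
  have hx0 : 0 ≤ x := (Finset.sum_nonneg fun k _ => (hpos k).le).trans hx
  have h1 : ∑ k ∈ Finset.range n, min 1 (x / a k) ≤ ∑' k, min 1 (x / a k) :=
    (summable_min_one_div ha x).sum_le_tsum _ fun k _ =>
      le_min zero_le_one (div_nonneg hx0 (hpos k).le)
  have h2 : ∑ k ∈ Finset.range n, min 1 (x / a k) = n := by
    rw [Finset.sum_congr rfl fun k hk => min_eq_left ?_, Finset.sum_const, Finset.card_range,
      nsmul_one]
    rw [le_div_iff₀ (hpos k), one_mul]
    exact (Finset.single_le_sum (fun k _ => (hpos k).le) hk).trans hx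
  rw [valleeDensity]
  linarith

theorem min_one_le_rpow {y s : ℝ} (hy : 0 ≤ y) (hs0 : 0 < s) (hs1 : s ≤ 1) :
    min 1 y ≤ y ^ s := by
  rcases le_total 1 y with h | h
  · exact (min_le_left _ _).trans (Real.one_le_rpow h hs0.le)
  · refine (min_le_right _ _).trans ?_
    rcases hy.eq_or_lt with rfl | hy'
    · simp [Real.zero_rpow hs0.ne']
    · simpa using Real.rpow_le_rpow_of_exponent_ge hy' h hs1

/-- Interpolating `min 1 y ≤ y ^ s` in every summand leaves `x ^ s ∑ aₖ⁻ˢ`, and `aₖ ≥ 2ᵏ` makes this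
sum geometric. With `s = σ - 1` this is the growth condition on `ψ(ν) / ν ^ σ`. -/
theorem exists_valleeDensity_le (ha : ∀ k, 2 ^ k ≤ a k) {s : ℝ} (hs0 : 0 < s) (hs1 : s ≤ 1) :
    ∃ c : ℝ, 0 ≤ c ∧ ∀ x, 0 ≤ x → valleeDensity a x ≤ 1 + c * x ^ s := by
  let q : ℝ := ((2 : ℝ) ^ s)⁻¹
  have hq0 : 0 ≤ q := by positivity
  have hq1 : q < 1 := inv_lt_one_of_one_lt₀ (Real.one_lt_rpow one_lt_two hs0)
  have hg := summable_geometric_of_lt_one hq0 hq1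
  refine ⟨∑' k, q ^ k, tsum_nonneg fun k => pow_nonneg hq0 k, fun x hx => ?_⟩
  rw [valleeDensity, ← tsum_mul_right]
  refine add_le_add le_rfl ((summable_min_one_div ha x).tsum_le_tsum (fun k => ?_)
    (hg.mul_right _))
  have hk := pos_of_two_pow_le ha k
  refine (min_one_le_rpow (div_nonneg hx hk.le) hs0 hs1).trans ?_
  calc (x / a k) ^ s ≤ (x / 2 ^ k) ^ s :=
        Real.rpow_le_rpow (div_nonneg hx hk.le)
          (div_le_div_of_nonneg_left hx (by positivity) (ha k)) hs0.le
    _ = q ^ k * x ^ s := by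
        rw [Real.div_rpow hx (by positivity), ← Real.rpow_natCast, ← Real.rpow_mul zero_le_two,
          mul_comm (k : ℝ), Real.rpow_mul zero_le_two, Real.rpow_natCast, div_eq_inv_mul, inv_pow]

theorem integral_valleeDensity_le (ha : ∀ k, 2 ^ k ≤ a k) {x : ℝ} (hx : 0 ≤ x) :
    ∫ t in (0 : ℝ)..x, valleeDensity a t ≤ x * valleeDensity a x := by
  have h := intervalIntegral.integral_mono_on (μ := volume) hx
    ((continuous_valleeDensity ha).intervalIntegrable 0 x)
    (continuous_const (y := valleeDensity a x)|>.intervalIntegrable 0 x)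
    fun t ht => monotone_valleeDensity ha ht.2
  simpa using h

/-- Only the right half of the interval is kept, where the density is at least its value at `x / 2`.
Superlinearity of the primitive follows. -/
theorem le_integral_valleeDensity (ha : ∀ k, 2 ^ k ≤ a k) {x : ℝ} (hx : 0 ≤ x) :
    x / 2 * valleeDensity a (x / 2) ≤ ∫ t in (0 : ℝ)..x, valleeDensity a t := by
  have hc := continuous_valleeDensity ha
  have h := intervalIntegral.integral_mono_on (μ := volume) (half_le_self hx)
    (continuous_const (y := valleeDensity a (x / 2))|>.intervalIntegrable (x / 2) x)
    (hc.intervalIntegrable (x / 2) x) fun t ht => monotone_valleeDensity ha ht.1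
  have h2 : 0 ≤ ∫ t in (0 : ℝ)..(x / 2), valleeDensity a t :=
    intervalIntegral.integral_nonneg (div_nonneg hx zero_le_two) fun t ht =>
      zero_le_one.trans (one_le_valleeDensity ha ht.1)
  rw [← intervalIntegral.integral_add_adjacent_intervals (hc.intervalIntegrable 0 (x / 2))
    (hc.intervalIntegrable (x / 2) x)]
  rw [intervalIntegral.integral_const, sub_half, smul_eq_mul] at h
  linarith

theorem isVallee_integral_valleeDensity (ha : ∀ k, 2 ^ k ≤ a k) :
    IsVallee fun x => ∫ t in (0 : ℝ)..x, valleeDensity a t := by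
  have hc := continuous_valleeDensity ha
  have hd : ∀ x, HasDerivAt (fun x => ∫ t in (0 : ℝ)..x, valleeDensity a t)
      (valleeDensity a x) x := fun x =>
    intervalIntegral.integral_hasDerivAt_right (hc.intervalIntegrable _ _)
      (hc.stronglyMeasurableAtFilter _ _) hc.continuousAt
  have hderiv : deriv (fun x => ∫ t in (0 : ℝ)..x, valleeDensity a t) = valleeDensity a :=
    funext fun x => (hd x).deriv
  have hdW : ∀ x ∈ Ici (0 : ℝ),
      derivWithin (fun x => ∫ t in (0 : ℝ)..x, valleeDensity a t) (Ici 0) x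
        = valleeDensity a x := fun x hx =>
    (hd x).hasDerivWithinAt.derivWithin (uniqueDiffOn_Ici 0 x hx)
  refine ⟨?_, ?_, ?_, ?_, ?_, ?_, ?_, ?_, ?_⟩
  · refine (Monotone.convexOn_univ_of_deriv (fun x => (hd x).differentiableAt) ?_).subset
      (subset_univ _) (convex_Ici 0)
    rw [hderiv]
    exact monotone_valleeDensity ha
  · exact fun x hx => intervalIntegral.integral_nonneg hx fun t ht =>
      zero_le_one.trans (one_le_valleeDensity ha ht.1)
  · refine ContDiff.contDiffOn (contDiff_one_iff_deriv.mpr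
      ⟨fun x => (hd x).differentiableAt, ?_⟩)
    rw [hderiv]
    exact hc
  · simp
  · rw [hdW 0 self_mem_Ici, valleeDensity_zero]
  · exact ((concaveOn_valleeDensity ha).subset (subset_univ _) (convex_Ici 0)).congr
      fun x hx => (hdW x hx).symm
  · refine (tendsto_valleeDensity ha).congr' ?_
    filter_upwards [eventually_ge_atTop 0] with x hx using (hdW x hx).symm
  · have h1 : Tendsto (fun x : ℝ => valleeDensity a (x / 2) / 2) atTop atTop :=
      ((tendsto_valleeDensity ha).comp (tendsto_id.atTop_div_const two_pos)).atTop_div_const two_pos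
    refine tendsto_atTop_mono' _ ?_ h1
    filter_upwards [eventually_gt_atTop 0] with x hx
    rw [le_div_iff₀ hx]
    calc valleeDensity a (x / 2) / 2 * x = x / 2 * valleeDensity a (x / 2) := by ring
      _ ≤ _ := le_integral_valleeDensity ha hx.le
  · intro σ hσ
    obtain ⟨c, hc0, hcb⟩ := exists_valleeDensity_le ha (s := σ - 1) (by linarith [hσ.1])
      (by linarith [hσ.2])
    refine ⟨1 + c, ?_⟩
    rintro _ ⟨x, hx, rfl⟩
    have hx1 : (1 : ℝ) ≤ x := hx
    have hx0 : 0 < x := by linarith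
    have hpow : x ^ σ = x * x ^ (σ - 1) := by
      rw [Real.rpow_sub_one hx0.ne']; field_simp
    have h1 : 1 ≤ x ^ (σ - 1) := Real.one_le_rpow hx1 (by linarith [hσ.1])
    show (∫ t in (0 : ℝ)..x, valleeDensity a t) / x ^ σ ≤ 1 + c
    rw [div_le_iff₀ (by positivity), hpow]
    calc _ ≤ x * valleeDensity a x := integral_valleeDensity_le ha hx0.le
      _ ≤ x * (1 + c * x ^ (σ - 1)) := mul_le_mul_of_nonneg_left (hcb x hx0.le) hx0.le
      _ ≤ x * ((1 + c) * x ^ (σ - 1)) := mul_le_mul_of_nonneg_left (by nlinarith) hx0.le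
      _ = _ := by ring

end valleeDensity

/-- Dominated convergence with majorant `f`: the integrand tends to 0 as `b → ∞`, so a large `b`
meets both demands. -/
theorem exists_two_pow_le_integral_le {X : Type*} [MeasurableSpace X] {μ : Measure X}
    {f : X → ℝ} (hf : Integrable f μ) (hf0 : 0 ≤ᵐ[μ] f) (k : ℕ) :
    ∃ b : ℝ, 2 ^ k ≤ b ∧
      ∫⁻ x, ENNReal.ofReal (f x * min 1 (f x / b)) ∂μ ≤ ENNReal.ofReal ((1 / 2) ^ k) := by
  let F : ℕ → X → ℝ := fun n x => f x * min 1 (f x / (n + 1))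
  have hFm : ∀ n, AEStronglyMeasurable (F n) μ := fun n =>
    hf.aestronglyMeasurable.mul (aestronglyMeasurable_const.inf
      (hf.aestronglyMeasurable.div₀ aestronglyMeasurable_const))
  have hF0 : ∀ n, 0 ≤ᵐ[μ] F n := fun n => by
    filter_upwards [hf0] with x hx
    exact mul_nonneg hx (le_min zero_le_one (div_nonneg hx (by positivity)))
  have hFb : ∀ n, ∀ᵐ x ∂μ, ‖F n x‖ ≤ f x := fun n => by
    filter_upwards [hf0, hF0 n] with x hx h0
    rw [Real.norm_of_nonneg h0]
    exact mul_le_of_le_one_right hx (min_le_left _ _)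
  have hlim : Tendsto (fun n => ∫ x, F n x ∂μ) atTop (𝓝 (∫ _, (0 : ℝ) ∂μ)) := by
    refine tendsto_integral_of_dominated_convergence f hFm hf hFb ?_
    filter_upwards with x
    have h1 : Tendsto (fun n : ℕ => f x / ((n : ℝ) + 1)) atTop (𝓝 0) := by
      simpa [div_eq_mul_inv] using
        (tendsto_one_div_add_atTop_nhds_zero_nat (𝕜 := ℝ)).const_mul (f x)
    have h2 := ((tendsto_const_nhds (x := (1 : ℝ))).min h1).const_mul (f x)
    simpa using h2
  rw [integral_zero] at hlim
  obtain ⟨n, hn1, hn2⟩ := ((hlim.eventually_le_const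
    (show (0 : ℝ) < (1 / 2) ^ k by positivity)).and (eventually_ge_atTop (2 ^ k))).exists
  refine ⟨n + 1, ?_, ?_⟩
  · have : ((2 ^ k : ℕ) : ℝ) ≤ n := Nat.cast_le.mpr hn2
    push_cast at this
    linarith
  · rw [← ofReal_integral_eq_lintegral_ofReal (hf.mono' (hFm n) (hFb n)) (hF0 n)]
    exact ENNReal.ofReal_le_ofReal hn1

/-- The refined de la Vallée Poussin theorem for one function. -/
theorem exists_isVallee {X : Type*} [MeasurableSpace X] {μ : Measure X}
    {f : X → ℝ} (hf : Integrable f μ) (hf0 : 0 ≤ᵐ[μ] f) :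
    ∃ ψ : ℝ → ℝ, IsVallee ψ ∧ ∫⁻ x, ENNReal.ofReal (ψ (f x)) ∂μ < ∞ := by
  choose a ha hint using exists_two_pow_le_integral_le hf hf0
  refine ⟨_, isVallee_integral_valleeDensity ha, ?_⟩
  -- As `ψ'` is monotone, `ψ(f) ≤ f ψ'(f) = f + ∑ₖ f min(1, f / aₖ)`, and the thresholds were chosen
  -- so that the `k`-th integral is at most `2⁻ᵏ`.
  have hle : ∀ᵐ x ∂μ, ENNReal.ofReal (∫ t in (0 : ℝ)..f x, valleeDensity a t)
      ≤ ENNReal.ofReal (f x) + ∑' k, ENNReal.ofReal (f x * min 1 (f x / a k)) := by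
    filter_upwards [hf0] with x hx
    have hx : 0 ≤ f x := hx
    have h0 : ∀ k, 0 ≤ f x * min 1 (f x / a k) := fun k =>
      mul_nonneg hx (le_min zero_le_one (div_nonneg hx (pos_of_two_pow_le ha k).le))
    rw [← ENNReal.ofReal_tsum_of_nonneg h0 ((summable_min_one_div ha _).mul_left _),
      ← ENNReal.ofReal_add hx (tsum_nonneg h0)]
    refine ENNReal.ofReal_le_ofReal ((integral_valleeDensity_le ha hx).trans (le_of_eq ?_))
    rw [valleeDensity, tsum_mul_left]
    ring
  refine (lintegral_mono_ae hle).trans_lt ?_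
  have hm : ∀ k, AEMeasurable (fun x => ENNReal.ofReal (f x * min 1 (f x / a k))) μ := fun k =>
    (hf.aemeasurable.mul (aemeasurable_const.min (hf.aemeasurable.div_const _))).ennreal_ofReal
  rw [lintegral_add_left' hf.aemeasurable.ennreal_ofReal, lintegral_tsum hm]
  refine ENNReal.add_lt_top.mpr ⟨?_, ?_⟩
  · rw [← ofReal_integral_eq_lintegral_ofReal hf hf0]
    exact ENNReal.ofReal_lt_top
  · refine (ENNReal.tsum_le_tsum hint).trans_lt ?_
    rw [← ENNReal.ofReal_tsum_of_nonneg (fun k => by positivity) summable_geometric_two]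
    exact ENNReal.ofReal_lt_top

/-! ### Doubling and quasi-subadditivity of de la Vallée Poussin functions. -/

namespace IsVallee

variable {ψ : ℝ → ℝ}

/-- Convexity and `ψ(0) = 0` give `ψ(x) ≤ (x / y) ψ(y)` for `x ≤ y`. -/
theorem monotoneOn (h : IsVallee ψ) : MonotoneOn ψ (Ici 0) := by
  intro x hx y hy hxy
  rcases (mem_Ici.mp hx).eq_or_lt with rfl | hx0
  · rw [h.zero]; exact h.nonneg y hy
  have hy0 : 0 < y := hx0.trans_le hxy
  have h1 := h.convex.2 (mem_Ici.mpr le_rfl) hy (sub_nonneg.mpr ((div_le_one hy0).mpr hxy))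
    (div_nonneg hx0.le hy0.le) (sub_add_cancel 1 (x / y))
  simp only [smul_eq_mul, mul_zero, zero_add, h.zero, div_mul_cancel₀ x hy0.ne'] at h1
  exact h1.trans (mul_le_of_le_one_left (h.nonneg y hy) ((div_le_one hy0).mpr hxy))

/-- Concavity of `ψ'` with `ψ'(0) = 1` gives `ψ'(2y) ≤ 2ψ'(y)`, so `4ψ(y) - ψ(2y)` has nonnegative
derivative and vanishes at 0. -/
theorem apply_two_mul_le (h : IsVallee ψ) {x : ℝ} (hx : 0 ≤ x) : ψ (2 * x) ≤ 4 * ψ x := by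
  have hd : ∀ y, 0 < y → HasDerivAt ψ (derivWithin ψ (Ici 0) y) y := fun y hy =>
    ((h.contDiff.differentiableOn one_ne_zero) y hy.le).hasDerivWithinAt.hasDerivAt
      (Ici_mem_nhds hy)
  have hd2 : ∀ y, 0 < y → HasDerivAt (fun y => 4 * ψ y - ψ (2 * y))
      (4 * derivWithin ψ (Ici 0) y - derivWithin ψ (Ici 0) (2 * y) * 2) y := fun y hy => by
    have h2 : HasDerivAt (fun y : ℝ => 2 * y) 2 y := by simpa using (hasDerivAt_id y).const_mul 2
    exact ((hd y hy).const_mul 4).sub ((hd (2 * y) (by positivity)).comp y h2)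
  have hmono : MonotoneOn (fun y => 4 * ψ y - ψ (2 * y)) (Ici 0) := by
    refine monotoneOn_of_deriv_nonneg (convex_Ici 0) ?_ ?_ ?_
    · refine (h.contDiff.continuousOn.const_mul 4).sub (h.contDiff.continuousOn.comp
        (by fun_prop) fun y hy => ?_)
      exact mul_nonneg zero_le_two (mem_Ici.mp hy)
    · rw [interior_Ici]
      exact fun y hy => (hd2 y hy).differentiableAt.differentiableWithinAt
    · rw [interior_Ici]
      intro y hy
      have hy0 : 0 < y := hy
      rw [(hd2 y hy).deriv]
      have h1 := h.deriv_concave.2 (mem_Ici.mpr le_rfl) (mem_Ici.mpr (by positivity : 0 ≤ 2 * y))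
        (by norm_num : (0 : ℝ) ≤ 1 / 2) (by norm_num : (0 : ℝ) ≤ 1 / 2) (by norm_num)
      simp only [smul_eq_mul, mul_zero, zero_add, h.deriv_zero] at h1
      rw [show 1 / 2 * (2 * y) = y by ring] at h1
      linarith
  have := hmono (mem_Ici.mpr le_rfl) hx hx
  simp only [mul_zero, h.zero, sub_zero] at this
  linarith

/-- The point `x + y` is the midpoint of `2x` and `2y`: convexity, then doubling. -/
theorem apply_add_le (h : IsVallee ψ) {x y : ℝ} (hx : 0 ≤ x) (hy : 0 ≤ y) :
    ψ (x + y) ≤ 2 * ψ x + 2 * ψ y := by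
  have h1 := h.convex.2 (mem_Ici.mpr (by positivity : 0 ≤ 2 * x))
    (mem_Ici.mpr (by positivity : 0 ≤ 2 * y))
    (by norm_num : (0 : ℝ) ≤ 1 / 2) (by norm_num : (0 : ℝ) ≤ 1 / 2) (by norm_num)
  simp only [smul_eq_mul] at h1
  rw [show 1 / 2 * (2 * x) + 1 / 2 * (2 * y) = x + y by ring] at h1
  linarith [h.apply_two_mul_le hx, h.apply_two_mul_le hy]

end IsVallee

/-! ### Pointwise bounds on the collision and breakage kernels. -/

section kernel

variable {lam α ζ η : ℝ}

theorem collisionKernel_nonneg (hlam : 0 < lam) {u v : ℝ} (hu : 0 < u) (hv : 0 < v) :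
    0 ≤ collisionKernel lam α ζ η u v := by
  unfold collisionKernel
  split_ifs <;> positivity

/-- If both volumes are at least 1, the exponent `η` may be raised to `1 - ζ`; weighted
arithmetic–geometric means of the two products then add up to exactly `u + v`. In the other cases a
factor is at most 1. -/
theorem collisionKernel_le (hlam : 0 < lam) (hα : 0 ≤ α) (hζ : 0 < ζ) (hζη : ζ ≤ η)
    (hsum : ζ + η ≤ 1) {u v : ℝ} (hu : 0 < u) (hv : 0 < v) :
    collisionKernel lam α ζ η u v ≤ lam * (u + v) := by
  have hneg : ∀ x : ℝ, 1 ≤ x → x ^ (-α) ≤ 1 := fun x hx =>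
    Real.rpow_le_one_of_one_le_of_nonpos hx (neg_nonpos.mpr hα)
  unfold collisionKernel
  split_ifs with h1 h2 h2
  · exact mul_le_mul_of_nonneg_left (by nlinarith) hlam.le
  · refine mul_le_mul_of_nonneg_left ?_ hlam.le
    have := mul_le_mul_of_nonneg_left (hneg v (not_lt.mp h2)) hu.le
    linarith
  · refine mul_le_mul_of_nonneg_left ?_ hlam.le
    have := mul_le_mul_of_nonneg_right (hneg u (not_lt.mp h1)) hv.le
    linarith
  · refine mul_le_mul_of_nonneg_left ?_ hlam.le
    have hu1 := not_lt.mp h1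
    have hv1 := not_lt.mp h2
    have hη' : η ≤ 1 - ζ := by linarith
    have hζ1 : 0 ≤ 1 - ζ := by linarith
    have e1 : u ^ ζ * v ^ η ≤ ζ * u + (1 - ζ) * v :=
      (mul_le_mul_of_nonneg_left (Real.rpow_le_rpow_of_exponent_le hv1 hη')
        (by positivity)).trans
        (Real.geom_mean_le_arith_mean2_weighted hζ.le hζ1 hu.le hv.le (by ring))
    have e2 : u ^ η * v ^ ζ ≤ (1 - ζ) * u + ζ * v :=
      (mul_le_mul_of_nonneg_right (Real.rpow_le_rpow_of_exponent_le hu1 hη')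
        (by positivity)).trans
        (Real.geom_mean_le_arith_mean2_weighted hζ1 hζ.le hu.le hv.le (by ring))
    linarith

end kernel

theorem supNorm_nonneg (R : ℝ) (B : ℝ → ℝ → ℝ → ℝ) : 0 ≤ supNorm R B :=
  Real.sSup_nonneg (by rintro _ ⟨p, _, rfl⟩; exact abs_nonneg _)

theorem IsBreakageKernel.le_supNorm {R : ℝ} {B : ℝ → ℝ → ℝ → ℝ} (hB : IsBreakageKernel R B)
    {m n z : ℝ} (hm : m ∈ Ioo 0 R) (hn : n ∈ Ioo 0 R) (hz : z ∈ Ioo 0 R) :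
    |B m n z| ≤ supNorm R B :=
  le_csSup hB.bounded ⟨(m, n, z), ⟨hm, hn, hz⟩, rfl⟩

theorem IsBreakageKernel.measurable_left {R : ℝ} {B : ℝ → ℝ → ℝ → ℝ}
    (hB : IsBreakageKernel R B) (n z : ℝ) : Measurable fun m => B m n z :=
  hB.measurable.comp (measurable_id.prodMk (measurable_const (a := (n, z))))

theorem IsBreakageKernel.integrableOn {R : ℝ} {B : ℝ → ℝ → ℝ → ℝ} (hB : IsBreakageKernel R B)
    {n z : ℝ} (hn : n ∈ Ioo 0 R) (hz : z ∈ Ioo 0 R) :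
    IntegrableOn (fun m => B m n z) (Ioc 0 n) := by
  refine Measure.integrableOn_of_bounded (M := supNorm R B) measure_Ioc_lt_top.ne
    (hB.measurable_left n z).aestronglyMeasurable ?_
  refine (ae_restrict_iff' measurableSet_Ioc).mpr (Eventually.of_forall fun m hm => ?_)
  exact hB.le_supNorm ⟨hm.1, hm.2.trans_lt hn.2⟩ hn hz

theorem IsBreakageKernel.integrableOn_mul {R : ℝ} {B : ℝ → ℝ → ℝ → ℝ}
    (hB : IsBreakageKernel R B) {n z : ℝ} (hn : n ∈ Ioo 0 R) (hz : z ∈ Ioo 0 R) (h : ℝ) :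
    IntegrableOn (fun m => (m + h) * B m n z) (Ioc 0 n) := by
  refine (hB.integrableOn hn hz).bdd_mul (c := |n| + |h|)
    (by fun_prop : Measurable fun m : ℝ => m + h).aestronglyMeasurable ?_
  refine (ae_restrict_iff' measurableSet_Ioc).mpr (Eventually.of_forall fun m hm => ?_)
  refine (norm_add_le _ _).trans (add_le_add ?_ le_rfl)
  rw [Real.norm_eq_abs, abs_of_pos hm.1]
  exact hm.2.trans (le_abs_self _)

theorem IsBreakageKernel.integral_le {R : ℝ} {B : ℝ → ℝ → ℝ → ℝ} (hB : IsBreakageKernel R B)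
    {n z : ℝ} (hn : n ∈ Ioo 0 R) (hz : z ∈ Ioo 0 R) {x y : ℝ} (hx : 0 ≤ x) (hxy : x ≤ y)
    (hy : y ≤ n) :
    ∫ m in Ioc x y, B m n z ≤ supNorm R B * (y - x) := by
  have h1 : ∫ m in Ioc x y, B m n z ≤ ∫ _ in Ioc x y, supNorm R B := by
    refine setIntegral_mono_on ((hB.integrableOn hn hz).mono_set (Ioc_subset_Ioc hx hy))
      (integrableOn_const measure_Ioc_lt_top.ne) measurableSet_Ioc fun m hm => ?_
    exact (le_abs_self _).trans
      (hB.le_supNorm ⟨hx.trans_lt hm.1, (hm.2.trans hy).trans_lt hn.2⟩ hn hz)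
  refine h1.trans (le_of_eq ?_)
  rw [setIntegral_const, Real.volume_real_Ioc_of_le hxy, smul_eq_mul, mul_comm]

/-! ### Mesh geometry, kernel averages and fragment sums. -/

namespace Mesh

variable {R : ℝ} (M : Mesh R)

theorem width_pos {a : ℕ} (ha : a < M.cells) : 0 < M.width a :=
  sub_pos.mpr (M.node_lt a ha)

theorem width_le_size {a : ℕ} (ha : a < M.cells) : M.width a ≤ M.size :=
  le_ciSup (f := fun a : Fin M.cells => M.width a) (Set.finite_range _).bddAbove ⟨a, ha⟩

theorem size_nonneg : 0 ≤ M.size := Real.iSup_nonneg fun a => (M.width_pos a.2).le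

theorem node_le_node {a b : ℕ} (hab : a ≤ b) (hb : b ≤ M.cells) : M.node a ≤ M.node b := by
  induction b, hab using Nat.le_induction with
  | base => exact le_rfl
  | succ n _ ih => exact (ih (by omega)).trans (M.node_lt n (by omega)).le

theorem node_nonneg {a : ℕ} (ha : a ≤ M.cells) : 0 ≤ M.node a :=
  M.node_zero.symm.le.trans (M.node_le_node (Nat.zero_le a) ha)

theorem node_le {a : ℕ} (ha : a ≤ M.cells) : M.node a ≤ R :=
  (M.node_le_node ha le_rfl).trans M.node_last.le

theorem node_lt_mid {a : ℕ} (ha : a < M.cells) : M.node a < M.mid a := by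
  have := M.node_lt a ha
  unfold mid; linarith

theorem mid_lt_node {a : ℕ} (ha : a < M.cells) : M.mid a < M.node (a + 1) := by
  have := M.node_lt a ha
  unfold mid; linarith

theorem mid_mem {a : ℕ} (ha : a < M.cells) : M.mid a ∈ Ioo 0 R :=
  ⟨(M.node_nonneg ha.le).trans_lt (M.node_lt_mid ha),
    (M.mid_lt_node ha).trans_le (M.node_le ha)⟩

/-- The only source of excess mass: a volume is replaced by the midpoint of its cell. -/
theorem mid_le_add_size {a : ℕ} (ha : a < M.cells) {m : ℝ} (hm : M.node a < m) :
    M.mid a ≤ m + M.size := by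
  have h1 := M.width_le_size ha
  have h2 := M.mid_lt_node ha
  unfold width at h1
  linarith

theorem cell_subset {a : ℕ} (ha : a < M.cells) : M.cell a ⊆ Ioc 0 R :=
  Ioc_subset_Ioc (M.node_nonneg ha.le) (M.node_le ha)

theorem node_lt_upper {a j : ℕ} (ha : a < M.cells) : M.node a < M.upper a j := by
  unfold upper
  split_ifs
  · exact M.node_lt_mid ha
  · exact M.node_lt a ha

theorem upper_le_mid {a j : ℕ} (haj : a ≤ j) (hj : j < M.cells) : M.upper a j ≤ M.mid j := by
  unfold upper
  split_ifs with h
  · rw [h]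
  · exact (M.node_le_node (by omega) hj.le).trans (M.node_lt_mid hj).le

theorem upper_le_node {a j : ℕ} (ha : a < M.cells) : M.upper a j ≤ M.node (a + 1) := by
  unfold upper
  split_ifs
  · exact (M.mid_lt_node ha).le
  · exact le_rfl

section kernelAvg

variable {K : ℝ → ℝ → ℝ} {a j : ℕ}

theorem kernelAvg_nonneg (hK : ∀ u v, 0 < u → 0 < v → 0 ≤ K u v) (ha : a < M.cells)
    (hj : j < M.cells) : 0 ≤ M.kernelAvg K a j := by
  have h1 := M.width_pos ha
  have h2 := M.width_pos hj
  refine mul_nonneg (by positivity) (setIntegral_nonneg measurableSet_Ioc fun v hv =>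
    setIntegral_nonneg measurableSet_Ioc fun u hu => hK u v ?_ ?_)
  · exact (M.cell_subset ha hu).1
  · exact (M.cell_subset hj hv).1

theorem setIntegral_cell_add (ha : a < M.cells) (v : ℝ) :
    ∫ u in M.cell a, (u + v) = M.width a * (M.mid a + v) := by
  unfold cell
  rw [← intervalIntegral.integral_of_le (M.node_lt a ha).le, intervalIntegral.integral_add
    (by simp) (by simp), integral_id, intervalIntegral.integral_const]
  unfold width mid
  rw [smul_eq_mul]
  ring

/-- The average of an affine function over a cell is its value at the midpoint, so the linear bound
passes to averages without error. -/
theorem kernelAvg_le {lam : ℝ} (hK : ∀ u v, 0 < u → 0 < v → 0 ≤ K u v)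
    (hK' : ∀ u v, 0 < u → 0 < v → K u v ≤ lam * (u + v)) (ha : a < M.cells) (hj : j < M.cells) :
    M.kernelAvg K a j ≤ lam * (M.mid a + M.mid j) := by
  have h1 := M.width_pos ha
  have h2 := M.width_pos hj
  have hin : ∀ v ∈ M.cell j, ∫ u in M.cell a, K u v ≤ lam * (M.width a * (M.mid a + v)) := by
    intro v hv
    have hv0 := (M.cell_subset hj hv).1
    rw [← M.setIntegral_cell_add ha, ← integral_const_mul]
    -- This comparison needs no integrability of `K`: a nonintegrable nonnegative function has
    -- integral 0 by convention.
    refine integral_mono_of_nonneg ?_ ?_ ?_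
    · exact (ae_restrict_iff' measurableSet_Ioc).mpr
        (Eventually.of_forall fun u hu => hK u v (M.cell_subset ha hu).1 hv0)
    · exact (Continuous.integrableOn_Ioc (by fun_prop) :
        IntegrableOn (fun u : ℝ => lam * (u + v)) (Ioc _ _))
    · exact (ae_restrict_iff' measurableSet_Ioc).mpr
        (Eventually.of_forall fun u hu => hK' u v (M.cell_subset ha hu).1 hv0)
  have hout : ∫ v in M.cell j, ∫ u in M.cell a, K u v
      ≤ ∫ v in M.cell j, lam * M.width a * (v + M.mid a) := by
    refine integral_mono_of_nonneg ?_ ?_ ?_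
    · exact (ae_restrict_iff' measurableSet_Ioc).mpr (Eventually.of_forall fun v hv =>
        setIntegral_nonneg measurableSet_Ioc fun u hu =>
          hK u v (M.cell_subset ha hu).1 (M.cell_subset hj hv).1)
    · exact (Continuous.integrableOn_Ioc (by fun_prop) :
        IntegrableOn (fun v : ℝ => lam * M.width a * (v + M.mid a)) (Ioc _ _))
    · exact (ae_restrict_iff' measurableSet_Ioc).mpr (Eventually.of_forall fun v hv =>
        (hin v hv).trans (le_of_eq (by ring)))
  rw [integral_const_mul, M.setIntegral_cell_add hj] at hout
  unfold kernelAvg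
  rw [one_div, inv_mul_le_iff₀ (by positivity)]
  exact hout.trans (le_of_eq (by ring))

end kernelAvg

section fragments

variable {B : ℝ → ℝ → ℝ → ℝ} {a j l : ℕ}

theorem fragments_nonneg (hB : IsBreakageKernel R B) (haj : a ≤ j) (hj : j < M.cells)
    (hl : l < M.cells) : 0 ≤ ∫ m in Ioc (M.node a) (M.upper a j), B m (M.mid j) (M.mid l) := by
  refine setIntegral_nonneg measurableSet_Ioc fun m hm => ?_
  refine hB.nonneg _ ⟨(M.node_nonneg (by omega)).trans_lt hm.1, ?_⟩ _ (M.mid_mem hj) _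
    (M.mid_mem hl)
  exact (hm.2.trans (M.upper_le_mid haj hj)).trans_lt (M.mid_mem hj).2

theorem fragments_le (hB : IsBreakageKernel R B) (haj : a ≤ j) (hj : j < M.cells)
    (hl : l < M.cells) :
    ∫ m in Ioc (M.node a) (M.upper a j), B m (M.mid j) (M.mid l) ≤ supNorm R B * M.width a := by
  have ha : a < M.cells := by omega
  refine (hB.integral_le (M.mid_mem hj) (M.mid_mem hl) (M.node_nonneg ha.le)
    (M.node_lt_upper ha).le (M.upper_le_mid haj hj)).trans ?_
  exact mul_le_mul_of_nonneg_left (sub_le_sub_right (M.upper_le_node ha) _) (supNorm_nonneg R B)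

/-- The intervals tile `(0, mid j]`: full cells below `j`, and the left half of cell `j`. This is
the purpose of the case distinction in `upper`. -/
theorem sum_setIntegral_upper (hj : j < M.cells) {F : ℝ → ℝ}
    (hF : IntegrableOn F (Ioc 0 (M.mid j))) :
    ∑ a ∈ Finset.range (j + 1), ∫ m in Ioc (M.node a) (M.upper a j), F m
      = ∫ m in Ioc 0 (M.mid j), F m := by
  have hI : ∀ {x y : ℝ}, 0 ≤ x → x ≤ y → y ≤ M.mid j → IntervalIntegrable F volume x y :=
    fun hx hxy hy => (intervalIntegrable_iff_integrableOn_Ioc_of_le hxy).mpr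
      (hF.mono_set (Ioc_subset_Ioc hx hy))
  have hle : ∀ k < j, M.node (k + 1) ≤ M.mid j := fun k hk =>
    (M.node_le_node hk hj.le).trans (M.node_lt_mid hj).le
  have h1 : ∑ a ∈ Finset.range j, ∫ m in Ioc (M.node a) (M.upper a j), F m
      = ∫ m in (0 : ℝ)..M.node j, F m := by
    have h2 := intervalIntegral.sum_integral_adjacent_intervals (f := F) (μ := volume)
      (a := M.node) (n := j) fun k hk => hI (M.node_nonneg (by omega))
        (M.node_lt k (by omega)).le (hle k hk)
    rw [M.node_zero] at h2
    rw [← h2]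
    refine Finset.sum_congr rfl fun k hk => ?_
    have hk := Finset.mem_range.mp hk
    rw [intervalIntegral.integral_of_le (M.node_lt k (by omega)).le, upper, if_neg (by omega)]
  have h0 := M.node_nonneg hj.le
  have hm := (M.node_lt_mid hj).le
  rw [Finset.sum_range_succ, h1, upper, if_pos rfl, ← intervalIntegral.integral_of_le hm,
    intervalIntegral.integral_add_adjacent_intervals (hI le_rfl h0 hm) (hI h0 hm le_rfl),
    intervalIntegral.integral_of_le (h0.trans hm)]

theorem sum_fragments_le (hB : IsBreakageKernel R B) (hj : j < M.cells) (hl : l < M.cells) :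
    ∑ a ∈ Finset.range (j + 1), ∫ m in Ioc (M.node a) (M.upper a j), B m (M.mid j) (M.mid l)
      ≤ supNorm R B * M.mid j := by
  rw [M.sum_setIntegral_upper hj (hB.integrableOn (M.mid_mem hj) (M.mid_mem hl))]
  simpa using hB.integral_le (M.mid_mem hj) (M.mid_mem hl) le_rfl (M.mid_mem hj).1.le le_rfl

/-- Each midpoint is at most `m + size` for `m` in its cell. The part with `m` is bounded by
`mass_le`, the rest by the supremum of `B`. -/
theorem sum_mid_mul_fragments_le (hB : IsBreakageKernel R B) (hj : j < M.cells)
    (hl : l < M.cells) :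
    ∑ a ∈ Finset.range (j + 1),
        M.mid a * ∫ m in Ioc (M.node a) (M.upper a j), B m (M.mid j) (M.mid l)
      ≤ M.mid j + M.size * (supNorm R B * M.mid j) := by
  have hj' := M.mid_mem hj
  have hl' := M.mid_mem hl
  have h1 : ∑ a ∈ Finset.range (j + 1),
        M.mid a * ∫ m in Ioc (M.node a) (M.upper a j), B m (M.mid j) (M.mid l)
      ≤ ∑ a ∈ Finset.range (j + 1),
        ∫ m in Ioc (M.node a) (M.upper a j), (m + M.size) * B m (M.mid j) (M.mid l) := by
    refine Finset.sum_le_sum fun a ha => ?_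
    have ha : a < j + 1 := Finset.mem_range.mp ha
    have hsub : Ioc (M.node a) (M.upper a j) ⊆ Ioc 0 (M.mid j) :=
      Ioc_subset_Ioc (M.node_nonneg (by omega)) (M.upper_le_mid (by omega) hj)
    rw [← integral_const_mul]
    refine setIntegral_mono_on (((hB.integrableOn hj' hl').mono_set hsub).const_mul _)
      ((hB.integrableOn_mul hj' hl' _).mono_set hsub) measurableSet_Ioc fun m hm => ?_
    refine mul_le_mul_of_nonneg_right (M.mid_le_add_size (by omega) hm.1) ?_
    exact hB.nonneg _ ⟨(hsub hm).1, (hsub hm).2.trans_lt hj'.2⟩ _ hj' _ hl'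
  refine h1.trans ?_
  rw [M.sum_setIntegral_upper hj (hB.integrableOn_mul hj' hl' _)]
  have h2 : ∫ m in Ioc 0 (M.mid j), (m + M.size) * B m (M.mid j) (M.mid l)
      = (∫ m in Ioc 0 (M.mid j), m * B m (M.mid j) (M.mid l))
        + M.size * ∫ m in Ioc 0 (M.mid j), B m (M.mid j) (M.mid l) := by
    rw [← integral_const_mul, ← integral_add]
    · simp only [add_mul]
    · simpa [IntegrableOn] using hB.integrableOn_mul hj' hl' 0
    · exact (hB.integrableOn hj' hl').const_mul _
  rw [h2]
  refine add_le_add ?_ (mul_le_mul_of_nonneg_left ?_ M.size_nonneg)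
  · rw [integral_Ioc_eq_integral_Ioo]
    exact hB.mass_le _ hj' _ hl'
  · simpa using hB.integral_le hj' hl' le_rfl hj'.1.le le_rfl

end fragments

end Mesh

/-! ### One Euler step: positivity, pointwise growth and growth of moments. -/

namespace Mesh

variable {R : ℝ} (M : Mesh R)

/-- The weighted sum `∑ₐ gₐ Cₐ Δmₐ` of a discrete density `C`. -/
noncomputable def moment (g C : ℕ → ℝ) : ℝ :=
  ∑ a ∈ Finset.range M.cells, g a * C a * M.width a

/-- The number of collisions `∑ₗ ∑ⱼ Kⱼₗ Cⱼ Cₗ Δmⱼ Δmₗ` per unit of time. -/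
noncomputable def collisions (K : ℝ → ℝ → ℝ) (C : ℕ → ℝ) : ℝ :=
  ∑ l ∈ Finset.range M.cells, ∑ j ∈ Finset.range M.cells,
    M.kernelAvg K j l * C j * C l * M.width j * M.width l

/-- The birth term of the cell `a`. -/
noncomputable def birth (K : ℝ → ℝ → ℝ) (B : ℝ → ℝ → ℝ → ℝ) (C : ℕ → ℝ) (a : ℕ) : ℝ :=
  ∑ l ∈ Finset.range M.cells, ∑ j ∈ Finset.Ico a M.cells,
    M.kernelAvg K j l * C j * C l * M.width j * M.width l
      * (∫ m in Ioc (M.node a) (M.upper a j), B m (M.mid j) (M.mid l))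

/-- One explicit Euler step. -/
noncomputable def step (K : ℝ → ℝ → ℝ) (B : ℝ → ℝ → ℝ → ℝ) (dt : ℝ) (C : ℕ → ℝ) (a : ℕ) : ℝ :=
  C a + dt / M.width a * M.birth K B C a
    - dt * ∑ j ∈ Finset.range M.cells, M.kernelAvg K a j * C a * C j * M.width j

theorem conc_succ (K : ℝ → ℝ → ℝ) (B : ℝ → ℝ → ℝ → ℝ) (Cin : ℝ → ℝ) (dt : ℝ) (n : ℕ) :
    M.conc K B Cin dt (n + 1) = M.step K B dt (M.conc K B Cin dt n) := by
  funext a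
  simp only [conc, step, birth]

variable {K : ℝ → ℝ → ℝ} {B : ℝ → ℝ → ℝ → ℝ} {lam dt : ℝ} {C : ℕ → ℝ}

theorem moment_nonneg {g : ℕ → ℝ} (hg : ∀ a < M.cells, 0 ≤ g a)
    (hC : ∀ a < M.cells, 0 ≤ C a) : 0 ≤ M.moment g C := by
  refine Finset.sum_nonneg fun a ha => ?_
  have ha := Finset.mem_range.mp ha
  exact mul_nonneg (mul_nonneg (hg a ha) (hC a ha)) (M.width_pos ha).le

theorem collision_term_nonneg (hK : ∀ u v, 0 < u → 0 < v → 0 ≤ K u v)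
    (hC : ∀ a < M.cells, 0 ≤ C a) {j l : ℕ} (hj : j < M.cells) (hl : l < M.cells) :
    0 ≤ M.kernelAvg K j l * C j * C l * M.width j * M.width l :=
  mul_nonneg (mul_nonneg (mul_nonneg (mul_nonneg (M.kernelAvg_nonneg hK hj hl) (hC j hj))
    (hC l hl)) (M.width_pos hj).le) (M.width_pos hl).le

theorem collisions_nonneg (hK : ∀ u v, 0 < u → 0 < v → 0 ≤ K u v)
    (hC : ∀ a < M.cells, 0 ≤ C a) : 0 ≤ M.collisions K C :=
  Finset.sum_nonneg fun _ hl => Finset.sum_nonneg fun _ hj =>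
    M.collision_term_nonneg hK hC (Finset.mem_range.mp hj) (Finset.mem_range.mp hl)

theorem death_le (hK : ∀ u v, 0 < u → 0 < v → 0 ≤ K u v)
    (hK' : ∀ u v, 0 < u → 0 < v → K u v ≤ lam * (u + v))
    (hC : ∀ a < M.cells, 0 ≤ C a) {a : ℕ} (ha : a < M.cells) :
    ∑ j ∈ Finset.range M.cells, M.kernelAvg K a j * C j * M.width j
      ≤ lam * (M.mid a * M.moment 1 C + M.moment M.mid C) := by
  unfold moment
  rw [Finset.mul_sum, ← Finset.sum_add_distrib, Finset.mul_sum]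
  refine Finset.sum_le_sum fun j hj => ?_
  have hj := Finset.mem_range.mp hj
  have h := mul_le_mul_of_nonneg_right (M.kernelAvg_le hK hK' ha hj)
    (mul_nonneg (hC j hj) (M.width_pos hj).le)
  simp only [Pi.one_apply]
  linarith

/-- Summing the loss-rate bound `death_le` against `C_j Δm_j`, both terms give the same product of
number and mass, whence the factor 2. -/
theorem collisions_le (hK : ∀ u v, 0 < u → 0 < v → 0 ≤ K u v)
    (hK' : ∀ u v, 0 < u → 0 < v → K u v ≤ lam * (u + v))
    (hC : ∀ a < M.cells, 0 ≤ C a) :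
    M.collisions K C ≤ 2 * lam * M.moment 1 C * M.moment M.mid C := by
  have h1 : M.collisions K C ≤ ∑ j ∈ Finset.range M.cells,
      C j * M.width j * (lam * (M.mid j * M.moment 1 C + M.moment M.mid C)) := by
    unfold collisions
    rw [Finset.sum_comm]
    refine Finset.sum_le_sum fun j hj => ?_
    have hj := Finset.mem_range.mp hj
    refine le_trans (le_of_eq ?_) (mul_le_mul_of_nonneg_left (M.death_le hK hK' hC hj)
      (mul_nonneg (hC j hj) (M.width_pos hj).le))
    rw [Finset.mul_sum]
    exact Finset.sum_congr rfl fun l _ => by ring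
  refine h1.trans (le_of_eq ?_)
  have h2 : ∀ p q : ℝ, ∑ j ∈ Finset.range M.cells, C j * M.width j * (lam * (M.mid j * p + q))
      = lam * (p * M.moment M.mid C + q * M.moment 1 C) := by
    intro p q
    unfold moment
    rw [Finset.mul_sum, Finset.mul_sum, ← Finset.sum_add_distrib, Finset.mul_sum]
    exact Finset.sum_congr rfl fun j _ => by simp only [Pi.one_apply]; ring
  rw [h2]
  ring

theorem birth_nonneg (hB : IsBreakageKernel R B) (hK : ∀ u v, 0 < u → 0 < v → 0 ≤ K u v)
    (hC : ∀ a < M.cells, 0 ≤ C a) (a : ℕ) : 0 ≤ M.birth K B C a := by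
  refine Finset.sum_nonneg fun l hl => Finset.sum_nonneg fun j hj => ?_
  obtain ⟨haj, hj⟩ := Finset.mem_Ico.mp hj
  have hl := Finset.mem_range.mp hl
  exact mul_nonneg (M.collision_term_nonneg hK hC hj hl) (M.fragments_nonneg hB haj hj hl)

/-- The factor `Δm_a` cancels the division by the cell width in the scheme; this makes the pointwise
gain per step uniform over cells. -/
theorem birth_le (hB : IsBreakageKernel R B) (hK : ∀ u v, 0 < u → 0 < v → 0 ≤ K u v)
    (hC : ∀ a < M.cells, 0 ≤ C a) {a : ℕ} (ha : a < M.cells) :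
    M.birth K B C a ≤ M.collisions K C * (supNorm R B * M.width a) := by
  unfold birth collisions
  rw [Finset.sum_mul]
  refine Finset.sum_le_sum fun l hl => ?_
  have hl := Finset.mem_range.mp hl
  have hb := mul_nonneg (supNorm_nonneg R B) (M.width_pos ha).le
  rw [Finset.sum_mul]
  refine le_trans (Finset.sum_le_sum fun j hj => ?_) (Finset.sum_le_sum_of_subset_of_nonneg
    (s := Finset.Ico a M.cells) ?_ fun j hj _ => ?_)
  · obtain ⟨haj, hj⟩ := Finset.mem_Ico.mp hj
    exact mul_le_mul_of_nonneg_left (M.fragments_le hB haj hj hl)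
      (M.collision_term_nonneg hK hC hj hl)
  · intro j hj
    exact Finset.mem_range.mpr (Finset.mem_Ico.mp hj).2
  · exact mul_nonneg (M.collision_term_nonneg hK hC (Finset.mem_range.mp hj) hl) hb

/-- Loss is proportional to `C a`, with a rate that `hstab` keeps below `1 / dt`; the birth term
only helps. -/
theorem step_nonneg (hB : IsBreakageKernel R B) (hK : ∀ u v, 0 < u → 0 < v → 0 ≤ K u v)
    (hK' : ∀ u v, 0 < u → 0 < v → K u v ≤ lam * (u + v)) (hlam : 0 < lam)
    (hC : ∀ a < M.cells, 0 ≤ C a) (hdt : 0 ≤ dt)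
    (hstab : dt * (lam * (R * M.moment 1 C + M.moment M.mid C)) ≤ 1) {a : ℕ}
    (ha : a < M.cells) : 0 ≤ M.step K B dt C a := by
  have h1 : 0 ≤ dt / M.width a * M.birth K B C a :=
    mul_nonneg (div_nonneg hdt (M.width_pos ha).le) (M.birth_nonneg hB hK hC a)
  have h2 : ∑ j ∈ Finset.range M.cells, M.kernelAvg K a j * C a * C j * M.width j
      = C a * ∑ j ∈ Finset.range M.cells, M.kernelAvg K a j * C j * M.width j := by
    rw [Finset.mul_sum]
    exact Finset.sum_congr rfl fun j _ => by ring
  have h3 : ∑ j ∈ Finset.range M.cells, M.kernelAvg K a j * C j * M.width j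
      ≤ lam * (R * M.moment 1 C + M.moment M.mid C) := by
    refine (M.death_le hK hK' hC ha).trans (mul_le_mul_of_nonneg_left ?_ hlam.le)
    exact add_le_add (mul_le_mul_of_nonneg_right (M.mid_mem ha).2.le
      (M.moment_nonneg (fun _ _ => zero_le_one) hC)) le_rfl
  have h4 := mul_le_mul_of_nonneg_left
    ((mul_le_mul_of_nonneg_left h3 hdt).trans hstab) (hC a ha)
  unfold step
  rw [h2]
  linarith

theorem step_le (hB : IsBreakageKernel R B) (hK : ∀ u v, 0 < u → 0 < v → 0 ≤ K u v)
    (hC : ∀ a < M.cells, 0 ≤ C a) (hdt : 0 ≤ dt) {a : ℕ} (ha : a < M.cells) :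
    M.step K B dt C a ≤ C a + dt * (supNorm R B * M.collisions K C) := by
  have hw := M.width_pos ha
  have h1 : dt / M.width a * M.birth K B C a ≤ dt * (supNorm R B * M.collisions K C) := by
    refine (mul_le_mul_of_nonneg_left (M.birth_le hB hK hC ha)
      (div_nonneg hdt hw.le)).trans (le_of_eq ?_)
    field_simp
  have h2 : 0 ≤ dt * ∑ j ∈ Finset.range M.cells, M.kernelAvg K a j * C a * C j * M.width j := by
    refine mul_nonneg hdt (Finset.sum_nonneg fun j hj => ?_)
    have hj := Finset.mem_range.mp hj
    exact mul_nonneg (mul_nonneg (mul_nonneg (M.kernelAvg_nonneg hK ha hj) (hC a ha)) (hC j hj))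
      (M.width_pos hj).le
  unfold step
  linarith

/-- A weight whose sum over the fragments of a particle exceeds its value at the particle by at
most `c` grows by at most `c` in each collision. -/
theorem moment_step_le (hK : ∀ u v, 0 < u → 0 < v → 0 ≤ K u v)
    (hC : ∀ a < M.cells, 0 ≤ C a) (hdt : 0 ≤ dt) {g : ℕ → ℝ} {c : ℝ}
    (hg : ∀ j < M.cells, ∀ l < M.cells, ∑ a ∈ Finset.range (j + 1),
      g a * ∫ m in Ioc (M.node a) (M.upper a j), B m (M.mid j) (M.mid l) ≤ g j + c) :
    M.moment g (M.step K B dt C) ≤ M.moment g C + dt * (c * M.collisions K C) := by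
  -- Exchanging the sums over `a ≤ j` regroups births by the parent `j` instead of by the fragment
  -- cell `a`.
  have e1 : ∑ a ∈ Finset.range M.cells, g a * M.birth K B C a
      = ∑ l ∈ Finset.range M.cells, ∑ j ∈ Finset.range M.cells,
        M.kernelAvg K j l * C j * C l * M.width j * M.width l * ∑ a ∈ Finset.range (j + 1),
          g a * ∫ m in Ioc (M.node a) (M.upper a j), B m (M.mid j) (M.mid l) := by
    unfold birth
    simp only [Finset.mul_sum]
    rw [Finset.sum_comm]
    refine Finset.sum_congr rfl fun l _ => ?_
    simp only [Finset.range_eq_Ico]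
    rw [Finset.sum_Ico_Ico_comm]
    exact Finset.sum_congr rfl fun j _ => Finset.sum_congr rfl fun a _ => by ring
  have e2 : ∑ a ∈ Finset.range M.cells, g a * M.width a *
        ∑ j ∈ Finset.range M.cells, M.kernelAvg K a j * C a * C j * M.width j
      = ∑ l ∈ Finset.range M.cells, ∑ j ∈ Finset.range M.cells,
        M.kernelAvg K j l * C j * C l * M.width j * M.width l * g j := by
    simp only [Finset.mul_sum]
    rw [Finset.sum_comm]
    exact Finset.sum_congr rfl fun l _ => Finset.sum_congr rfl fun j _ => by ring
  have e3 : M.moment g (M.step K B dt C) = M.moment g C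
      + dt * (∑ a ∈ Finset.range M.cells, g a * M.birth K B C a
        - ∑ a ∈ Finset.range M.cells, g a * M.width a *
          ∑ j ∈ Finset.range M.cells, M.kernelAvg K a j * C a * C j * M.width j) := by
    unfold moment
    rw [← Finset.sum_sub_distrib, Finset.mul_sum, ← Finset.sum_add_distrib]
    refine Finset.sum_congr rfl fun a ha => ?_
    have hw := (M.width_pos (Finset.mem_range.mp ha)).ne'
    unfold step
    field_simp
    ring
  rw [e3, e1, e2]
  refine add_le_add le_rfl (mul_le_mul_of_nonneg_left ?_ hdt)
  unfold collisions
  rw [Finset.mul_sum, ← Finset.sum_sub_distrib]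
  refine Finset.sum_le_sum fun l hl => ?_
  rw [Finset.mul_sum, ← Finset.sum_sub_distrib]
  refine Finset.sum_le_sum fun j hj => ?_
  have hj := Finset.mem_range.mp hj
  have hl := Finset.mem_range.mp hl
  have := mul_le_mul_of_nonneg_left (hg j hj l hl) (M.collision_term_nonneg hK hC hj hl)
  linarith

/-- A parent yields at most `‖B‖ R` fragments; the removal of the parent itself is discarded. -/
theorem moment_one_step_le (hB : IsBreakageKernel R B)
    (hK : ∀ u v, 0 < u → 0 < v → 0 ≤ K u v) (hC : ∀ a < M.cells, 0 ≤ C a) (hdt : 0 ≤ dt) :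
    M.moment 1 (M.step K B dt C)
      ≤ M.moment 1 C + dt * (supNorm R B * R * M.collisions K C) := by
  refine M.moment_step_le hK hC hdt fun j hj l hl => ?_
  simp only [Pi.one_apply, one_mul]
  have h1 := M.sum_fragments_le hB hj hl
  have h2 := mul_le_mul_of_nonneg_left (M.mid_mem hj).2.le (supNorm_nonneg R B)
  linarith

/-- The gain per collision carries the factor `M.size`, so mass growth becomes negligible on fine
meshes. -/
theorem moment_mid_step_le (hB : IsBreakageKernel R B)
    (hK : ∀ u v, 0 < u → 0 < v → 0 ≤ K u v) (hC : ∀ a < M.cells, 0 ≤ C a) (hdt : 0 ≤ dt) :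
    M.moment M.mid (M.step K B dt C)
      ≤ M.moment M.mid C + dt * (M.size * (supNorm R B * R) * M.collisions K C) := by
  refine M.moment_step_le hK hC hdt fun j hj l hl => ?_
  refine (M.sum_mid_mul_fragments_le hB hj hl).trans (add_le_add le_rfl ?_)
  exact mul_le_mul_of_nonneg_left (mul_le_mul_of_nonneg_left (M.mid_mem hj).2.le
    (supNorm_nonneg R B)) M.size_nonneg

/-! ### Moments of the discretized initial datum. -/

section initial

variable {Cin : ℝ → ℝ}

theorem sum_setIntegral_cell {F : ℝ → ℝ} (hF : IntegrableOn F (Ioo 0 R)) :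
    ∑ a ∈ Finset.range M.cells, ∫ m in M.cell a, F m = ∫ m in Ioo 0 R, F m := by
  have hF' : IntegrableOn F (Ioc 0 R) := (integrableOn_Ioc_iff_integrableOn_Ioo).mpr hF
  have h := intervalIntegral.sum_integral_adjacent_intervals (f := F) (μ := volume)
      (a := M.node) (n := M.cells) fun k hk =>
        (intervalIntegrable_iff_integrableOn_Ioc_of_le (M.node_lt k hk).le).mpr
          (hF'.mono_set (M.cell_subset hk))
  rw [M.node_zero, M.node_last, intervalIntegral.integral_of_le
    (M.node_last ▸ M.node_nonneg le_rfl), integral_Ioc_eq_integral_Ioo] at h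
  rw [← h]
  refine Finset.sum_congr rfl fun k hk => ?_
  rw [intervalIntegral.integral_of_le (M.node_lt k (Finset.mem_range.mp hk)).le, cell]

theorem ae_cell {p : ℝ → Prop} (hp : ∀ᵐ m ∂(volume.restrict (Ioo 0 R)), p m) {a : ℕ}
    (ha : a < M.cells) : ∀ᵐ m ∂(volume.restrict (M.cell a)), p m := by
  rw [Measure.restrict_congr_set Ioo_ae_eq_Ioc] at hp
  exact ae_restrict_of_ae_restrict_of_subset (M.cell_subset ha) hp

theorem conc_zero_nonneg (hCin0 : ∀ᵐ m ∂(volume.restrict (Ioo 0 R)), 0 ≤ Cin m) {a : ℕ}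
    (ha : a < M.cells) : 0 ≤ M.conc K B Cin dt 0 a := by
  simp only [conc]
  exact mul_nonneg (one_div_nonneg.mpr (M.width_pos ha).le)
    (integral_nonneg_of_ae (M.ae_cell hCin0 ha))

theorem moment_conc_zero (g : ℕ → ℝ) :
    M.moment g (M.conc K B Cin dt 0)
      = ∑ a ∈ Finset.range M.cells, g a * ∫ m in M.cell a, Cin m := by
  unfold moment
  refine Finset.sum_congr rfl fun a ha => ?_
  have hw := (M.width_pos (Finset.mem_range.mp ha)).ne'
  simp only [conc]
  field_simp

theorem moment_one_conc_zero (hCin : IntegrableOn Cin (Ioo 0 R))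
    (hCin0 : ∀ᵐ m ∂(volume.restrict (Ioo 0 R)), 0 ≤ Cin m) :
    M.moment 1 (M.conc K B Cin dt 0) = initialNorm R Cin := by
  rw [moment_conc_zero]
  simp only [Pi.one_apply, one_mul]
  rw [M.sum_setIntegral_cell hCin, initialNorm]
  refine integral_congr_ae ?_
  filter_upwards [hCin0] with m hm using (abs_of_nonneg hm).symm

theorem moment_mid_conc_zero_le (hCin : IntegrableOn Cin (Ioo 0 R))
    (hCin0 : ∀ᵐ m ∂(volume.restrict (Ioo 0 R)), 0 ≤ Cin m) :
    M.moment M.mid (M.conc K B Cin dt 0) ≤ initialMass R Cin + M.size * initialNorm R Cin := by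
  have hi : IntegrableOn (fun m => m * Cin m) (Ioo 0 R) := by
    refine hCin.bdd_mul (c := R) measurable_id.aestronglyMeasurable ?_
    refine (ae_restrict_iff' measurableSet_Ioo).mpr (Eventually.of_forall fun m hm => ?_)
    exact (Real.norm_of_nonneg hm.1.le).trans_le hm.2.le
  have hi' : IntegrableOn (fun m => m * Cin m + M.size * Cin m) (Ioo 0 R) :=
    hi.add (hCin.const_mul _)
  have h1 : ∫ m in Ioo 0 R, (m * Cin m + M.size * Cin m)
      = initialMass R Cin + M.size * initialNorm R Cin := by
    rw [integral_add hi (hCin.const_mul _), integral_const_mul, initialMass, initialNorm]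
    congr 2
    refine integral_congr_ae ?_
    filter_upwards [hCin0] with m hm using (abs_of_nonneg hm).symm
  rw [moment_conc_zero, ← h1, ← M.sum_setIntegral_cell hi']
  refine Finset.sum_le_sum fun a ha => ?_
  have ha := Finset.mem_range.mp ha
  have hsub : ∀ {F : ℝ → ℝ}, IntegrableOn F (Ioo 0 R) → IntegrableOn F (M.cell a) := fun hF =>
    ((integrableOn_Ioc_iff_integrableOn_Ioo).mpr hF).mono_set (M.cell_subset ha)
  rw [← integral_const_mul]
  refine integral_mono_ae ((hsub hCin).const_mul _) (hsub hi') ?_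
  filter_upwards [M.ae_cell hCin0 ha, ae_restrict_mem (measurableSet_Ioc (a := M.node a)
    (b := M.node (a + 1)))] with m hm hm'
  have := mul_le_mul_of_nonneg_right (M.mid_le_add_size ha hm'.1) hm
  linarith

end initial

end Mesh

/-! ### Bounds uniform in mesh and time step. -/

/-- Under the stability condition the scheme on fine meshes is nonnegative, and its solution exceeds
the discrete initial datum at most by a constant that depends neither on the mesh nor on the
time step. -/
theorem exists_conc_bounds {lam T R θ : ℝ} {K : ℝ → ℝ → ℝ} {B : ℝ → ℝ → ℝ → ℝ} {Cin : ℝ → ℝ}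
    (hlam : 0 < lam) (hT : 0 < T) (hR : 0 < R) (hθ1 : θ < 1) (hB : IsBreakageKernel R B)
    (hK : ∀ u v, 0 < u → 0 < v → 0 ≤ K u v)
    (hK' : ∀ u v, 0 < u → 0 < v → K u v ≤ lam * (u + v))
    (hCin : IntegrableOn Cin (Ioo 0 R))
    (hCin0 : ∀ᵐ m ∂(volume.restrict (Ioo 0 R)), 0 ≤ Cin m) :
    ∃ h₀ : ℝ, 0 < h₀ ∧ ∃ G : ℝ, 0 ≤ G ∧ ∀ (M : Mesh R) (N : ℕ), 0 < N → M.size ≤ h₀ →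
      stabilityConst lam T R B Cin * (T / N) ≤ θ → ∀ n ≤ N, ∀ a < M.cells,
        0 ≤ M.conc K B Cin (T / N) n a ∧
        M.conc K B Cin (T / N) n a ≤ M.conc K B Cin (T / N) 0 a + G := by
  set b := supNorm R B with hb
  set n₀ := initialNorm R Cin with hn₀
  set m₁ := initialMass R Cin with hm₁
  have hb0 : 0 ≤ b := supNorm_nonneg R B
  have hn0 : 0 ≤ n₀ := integral_nonneg fun _ => abs_nonneg _
  have hm0 : 0 ≤ m₁ := by
    refine integral_nonneg_of_ae ?_
    filter_upwards [hCin0, ae_restrict_mem measurableSet_Ioo] with m hm hm'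
    exact mul_nonneg hm'.1.le hm
  set c := 2 * lam * R * b with hc
  have hc0 : 0 ≤ c := by positivity
  have hlog : 0 < Real.log (3 / 2) := Real.log_pos (by norm_num)
  -- `Mb = m₁ + δ n₀` will bound the mass. The second condition gives `E ≤ (3/2) E₀`, the first
  -- bounds the added mass by `(R/2) n₀`; together they use up the factor `2 = 3/2 + 1/2` in
  -- `S(T,R)`.
  obtain ⟨δ, hδ0, hδR, hδe⟩ : ∃ δ : ℝ, 0 < δ ∧ δ ≤ R / 2 ∧ c * n₀ * T * δ ≤ Real.log (3 / 2) := by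
    refine ⟨min (R / 2) (Real.log (3 / 2) / (1 + c * n₀ * T)), by positivity, min_le_left _ _, ?_⟩
    have h1 := min_le_right (R / 2) (Real.log (3 / 2) / (1 + c * n₀ * T))
    have h2 : 0 ≤ c * n₀ * T := by positivity
    refine (mul_le_mul_of_nonneg_left h1 h2).trans ?_
    rw [mul_div_assoc', div_le_iff₀ (by positivity)]
    nlinarith
  set Mb := m₁ + δ * n₀ with hMb
  have hMb0 : 0 ≤ Mb := by positivity
  set E := Real.exp (c * Mb * T) with hE
  have hE0 : 0 < E := Real.exp_pos _
  set E₀ := Real.exp (c * m₁ * T) with hE₀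
  have hE01 : 1 ≤ E₀ := Real.one_le_exp (by positivity)
  have hEE : E ≤ 3 / 2 * E₀ := by
    have : c * Mb * T = c * n₀ * T * δ + c * m₁ * T := by rw [hMb]; ring
    rw [hE, this, Real.exp_add]
    refine mul_le_mul_of_nonneg_right ?_ (Real.exp_pos _).le
    rw [← Real.exp_log (show (0 : ℝ) < 3 / 2 by norm_num)]
    exact Real.exp_le_exp.mpr hδe
  have hD : 0 < 1 + T * (c * E * Mb) := by positivity
  -- This mesh size makes `size (1 + T c E Mb) ≤ δ`, keeping the mass below `Mb` up to time `T`. The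
  -- second constant is `T` times the largest possible pointwise birth rate.
  refine ⟨δ / (1 + T * (c * E * Mb)), div_pos hδ0 hD, T * (b * (2 * lam * (n₀ * E) * Mb)),
    by positivity, ?_⟩
  intro M N hN hsize hstab
  have hN0 : (0 : ℝ) < N := Nat.cast_pos.mpr hN
  set dt := T / N with hdt
  have hdt0 : 0 ≤ dt := by positivity
  have hs0 := M.size_nonneg
  rw [le_div_iff₀ hD] at hsize
  have htime : ∀ n : ℕ, n ≤ N → n * dt ≤ T := fun n hn => by
    rw [hdt, mul_div_assoc', div_le_iff₀ hN0, mul_comm]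
    exact mul_le_mul_of_nonneg_left (Nat.cast_le.mpr hn) hT.le
  have hstab' : dt * (lam * (R * (n₀ * E) + Mb)) ≤ 1 := by
    refine le_trans ?_ (hstab.trans hθ1.le)
    have e : stabilityConst lam T R B Cin = lam * (2 * R * n₀ * E₀ + m₁) := by
      simp only [stabilityConst, hE₀, hc, ← hb, ← hn₀, ← hm₁]
    rw [e, mul_comm dt]
    refine mul_le_mul_of_nonneg_right (mul_le_mul_of_nonneg_left ?_ hlam.le) hdt0
    have h1 : R * n₀ * E ≤ R * n₀ * (3 / 2 * E₀) := mul_le_mul_of_nonneg_left hEE (by positivity)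
    have h2 : δ * n₀ ≤ R / 2 * n₀ := mul_le_mul_of_nonneg_right hδR hn0
    have h3 : R / 2 * n₀ * 1 ≤ R / 2 * n₀ * E₀ :=
      mul_le_mul_of_nonneg_left hE01 (by positivity)
    rw [hMb]
    linarith
  -- The four bounds are proved by a joint induction: positivity justifies the moment estimates,
  -- which in turn bound the loss rate. The ceilings `n₀ E` and `Mb`, fixed in advance, keep the
  -- constants from deteriorating with `n`.
  have key : ∀ n ≤ N, (∀ a < M.cells, 0 ≤ M.conc K B Cin dt n a) ∧
      M.moment 1 (M.conc K B Cin dt n) ≤ n₀ * Real.exp (c * Mb * (n * dt)) ∧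
      M.moment M.mid (M.conc K B Cin dt n) ≤ m₁ + M.size * n₀ * (1 + n * dt * (c * E * Mb)) ∧
      ∀ a < M.cells, M.conc K B Cin dt n a
        ≤ M.conc K B Cin dt 0 a + n * dt * (b * (2 * lam * (n₀ * E) * Mb)) := by
    intro n
    induction n with
    | zero =>
      refine fun _ => ⟨fun a ha => M.conc_zero_nonneg hCin0 ha, ?_, ?_, fun a _ => ?_⟩
      · rw [M.moment_one_conc_zero hCin hCin0]; simp [hn₀]
      · refine (M.moment_mid_conc_zero_le hCin hCin0).trans ?_
        simp [hn₀, hm₁]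
      · simp
    | succ n ih =>
      intro hn
      obtain ⟨hC, h1, h2, h3⟩ := ih (by omega)
      rw [M.conc_succ]
      set C := M.conc K B Cin dt n with hCdef
      have ht := htime n (by omega)
      have hN1 : 0 ≤ M.moment 1 C := M.moment_nonneg (fun _ _ => zero_le_one) hC
      have hM1 : 0 ≤ M.moment M.mid C := M.moment_nonneg (fun a ha => (M.mid_mem ha).1.le) hC
      have h1' : M.moment 1 C ≤ n₀ * E := h1.trans (mul_le_mul_of_nonneg_left
        (Real.exp_le_exp.mpr (mul_le_mul_of_nonneg_left ht (by positivity))) hn0)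
      have h2' : M.moment M.mid C ≤ Mb := by
        refine h2.trans ?_
        have e1 : n * dt * (c * E * Mb) ≤ T * (c * E * Mb) :=
          mul_le_mul_of_nonneg_right ht (by positivity)
        have e2 := mul_le_mul_of_nonneg_left (add_le_add (le_refl (1 : ℝ)) e1)
          (mul_nonneg hs0 hn0)
        have e3 := mul_le_mul_of_nonneg_right hsize hn0
        rw [hMb]
        linarith
      have hQ0 := M.collisions_nonneg hK hC
      have hQ1 : M.collisions K C ≤ 2 * lam * M.moment 1 C * Mb :=
        (M.collisions_le hK hK' hC).trans (mul_le_mul_of_nonneg_left h2' (by positivity))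
      have hQ2 : M.collisions K C ≤ 2 * lam * (n₀ * E) * Mb :=
        hQ1.trans (mul_le_mul_of_nonneg_right (mul_le_mul_of_nonneg_left h1' (by positivity)) hMb0)
      refine ⟨fun a ha => M.step_nonneg hB hK hK' hlam hC hdt0 ?_ ha, ?_, ?_, fun a ha => ?_⟩
      · refine le_trans (mul_le_mul_of_nonneg_left (mul_le_mul_of_nonneg_left
          (add_le_add (mul_le_mul_of_nonneg_left h1' hR.le) h2') hlam.le) hdt0) hstab'
      · refine (M.moment_one_step_le hB hK hC hdt0).trans ?_
        have e1 : dt * (b * R * M.collisions K C) ≤ M.moment 1 C * (c * Mb * dt) := by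
          refine (mul_le_mul_of_nonneg_left (mul_le_mul_of_nonneg_left hQ1
            (mul_nonneg hb0 hR.le)) hdt0).trans (le_of_eq ?_)
          rw [hc]; ring
        have e2 : c * Mb * ((n + 1 : ℕ) * dt) = c * Mb * (n * dt) + c * Mb * dt := by
          push_cast; ring
        rw [e2, Real.exp_add, ← mul_assoc n₀]
        calc M.moment 1 C + dt * (b * R * M.collisions K C)
            ≤ M.moment 1 C * (c * Mb * dt + 1) := by linarith
          _ ≤ M.moment 1 C * Real.exp (c * Mb * dt) :=
              mul_le_mul_of_nonneg_left (Real.add_one_le_exp _) hN1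
          _ ≤ _ := mul_le_mul_of_nonneg_right h1 (Real.exp_pos _).le
      · refine (M.moment_mid_step_le hB hK hC hdt0).trans ?_
        have e1 : dt * (M.size * (b * R) * M.collisions K C)
            ≤ M.size * n₀ * (dt * (c * E * Mb)) := by
          refine (mul_le_mul_of_nonneg_left (mul_le_mul_of_nonneg_left hQ2
            (mul_nonneg hs0 (mul_nonneg hb0 hR.le))) hdt0).trans (le_of_eq ?_)
          rw [hc]; ring
        push_cast
        linarith
      · refine (M.step_le hB hK hC hdt0 ha).trans ?_
        have e1 := mul_le_mul_of_nonneg_left (mul_le_mul_of_nonneg_left hQ2 hb0) hdt0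
        have e2 := h3 a ha
        push_cast
        linarith
  intro n hn a ha
  obtain ⟨h1, -, -, h4⟩ := key n hn
  refine ⟨h1 a ha, (h4 a ha).trans (add_le_add le_rfl ?_)⟩
  exact mul_le_mul_of_nonneg_right (htime n hn) (by positivity)

/-! ### The approximation as a function on space-time. -/

namespace Mesh

variable {R : ℝ} (M : Mesh R) {K : ℝ → ℝ → ℝ} {B : ℝ → ℝ → ℝ → ℝ} {Cin : ℝ → ℝ} {T : ℝ} {N : ℕ}

theorem exists_mem_cell {m : ℝ} (hm : m ∈ Ioc 0 R) : ∃ a < M.cells, m ∈ M.cell a := by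
  have h : ∀ k ≤ M.cells, m ≤ M.node k → ∃ a < M.cells, m ∈ M.cell a := by
    intro k
    induction k with
    | zero =>
      intro _ h
      rw [M.node_zero] at h
      exact absurd hm.1 (not_lt.mpr h)
    | succ k ih =>
      intro hk h
      rcases le_or_gt m (M.node k) with h' | h'
      · exact ih (by omega) h'
      · exact ⟨k, by omega, h', h⟩
  exact h M.cells le_rfl (hm.2.trans M.node_last.ge)

theorem eq_of_mem_cell {m : ℝ} {a a' : ℕ} (ha : a < M.cells) (ha' : a' < M.cells)
    (h : m ∈ M.cell a) (h' : m ∈ M.cell a') : a = a' := by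
  by_contra hne
  rcases Nat.lt_or_gt_of_ne hne with hlt | hlt
  · exact absurd (h.2.trans (M.node_le_node hlt ha'.le)) (not_le.mpr h'.1)
  · exact absurd (h'.2.trans (M.node_le_node hlt ha.le)) (not_le.mpr h.1)

theorem eq_of_mem_Ico_mul {dt t : ℝ} (hdt : 0 ≤ dt) {n n' : ℕ}
    (h : t ∈ Ico (n * dt) ((n + 1) * dt)) (h' : t ∈ Ico (n' * dt) ((n' + 1) * dt)) : n = n' := by
  by_contra hne
  have aux : ∀ {i j : ℕ}, i < j → t < (i + 1) * dt → (j : ℝ) * dt ≤ t → False := by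
    intro i j hij h1 h2
    have : ((i : ℝ) + 1) ≤ j := by exact_mod_cast hij
    exact absurd (h1.trans_le (mul_le_mul_of_nonneg_right this hdt)) (not_lt.mpr h2)
  rcases Nat.lt_or_gt_of_ne hne with hlt | hlt
  · exact aux hlt h.2 h'.1
  · exact aux hlt h'.2 h.1

/-- The approximation takes the value of the scheme on each space-time cell, and vanishes off
them. -/
theorem approx_eq_zero_or (hT : 0 ≤ T) (p : ℝ × ℝ) :
    M.approx K B Cin T N p = 0 ∨ ∃ n < N, ∃ a < M.cells, p.2 ∈ M.cell a ∧
      M.approx K B Cin T N p = M.conc K B Cin (T / N) n a := by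
  by_cases hex : ∃ n < N, ∃ a < M.cells, p.2 ∈ M.cell a ∧
      p.1 ∈ Ico ((n : ℝ) * (T / N)) ((n + 1) * (T / N))
  · obtain ⟨n, hn, a, ha, hpa, hpn⟩ := hex
    refine Or.inr ⟨n, hn, a, ha, hpa, ?_⟩
    unfold approx
    rw [Finset.sum_eq_single_of_mem n (Finset.mem_range.mpr hn),
      Finset.sum_eq_single_of_mem a (Finset.mem_range.mpr ha)]
    · rw [indicator_of_mem hpa, indicator_of_mem hpn]; simp
    · intro a' ha' hne
      rw [indicator_of_notMem fun h =>
        hne (M.eq_of_mem_cell (Finset.mem_range.mp ha') ha h hpa)]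
      simp
    · intro n' _ hne
      refine Finset.sum_eq_zero fun a' _ => ?_
      rw [indicator_of_notMem (s := Ico _ _) fun h =>
        hne (eq_of_mem_Ico_mul (by positivity) h hpn)]
      simp
  · refine Or.inl (Finset.sum_eq_zero fun n hn => Finset.sum_eq_zero fun a ha => ?_)
    by_cases hpa : p.2 ∈ M.cell a
    · rw [indicator_of_notMem (s := Ico _ _) fun h =>
        hex ⟨n, Finset.mem_range.mp hn, a, Finset.mem_range.mp ha, hpa, h⟩, mul_zero]
    · rw [indicator_of_notMem hpa, mul_zero, zero_mul]

theorem integrable_approx (μ : Measure (ℝ × ℝ)) [IsFiniteMeasure μ] :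
    Integrable (M.approx K B Cin T N) μ := by
  have hind : ∀ (s : Set ℝ) (x : ℝ), ‖s.indicator (1 : ℝ → ℝ) x‖ ≤ 1 := fun s x => by
    by_cases h : x ∈ s <;> simp [h]
  unfold approx
  refine integrable_finsetSum _ fun n _ => integrable_finsetSum _ fun a _ => ?_
  refine Integrable.of_bound ?_ ‖M.conc K B Cin (T / N) n a‖ (Eventually.of_forall fun p => ?_)
  · refine Measurable.aestronglyMeasurable ?_
    exact (((measurable_one.indicator measurableSet_Ioc).comp measurable_snd).const_mul _).mul
      ((measurable_one.indicator measurableSet_Ico).comp measurable_fst)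
  · rw [norm_mul, norm_mul, mul_assoc]
    exact mul_le_of_le_one_right (norm_nonneg _)
      (mul_le_one₀ (hind _ _) (norm_nonneg _) (hind _ _))

theorem sum_width : ∑ a ∈ Finset.range M.cells, M.width a = R := by
  unfold width
  rw [Finset.sum_range_sub, M.node_zero, M.node_last, sub_zero]

end Mesh

/-! ### Entropy bound and uniform integrability. -/

section entropy

variable {R T : ℝ} {Cin ψ : ℝ → ℝ}

theorem IsVallee.integrableOn_comp (hψ : IsVallee ψ) (hCin : IntegrableOn Cin (Ioo 0 R))
    (hCin0 : ∀ᵐ m ∂(volume.restrict (Ioo 0 R)), 0 ≤ Cin m)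
    (hfin : ∫⁻ m in Ioo 0 R, ENNReal.ofReal (ψ (Cin m)) < ∞) :
    IntegrableOn (fun m => ψ (Cin m)) (Ioo 0 R) := by
  -- Regularity of `ψ` is known on `[0, ∞)` only; measurability goes through this continuous
  -- extension.
  have hcont : Continuous fun x => ψ (max 0 x) :=
    hψ.contDiff.continuousOn.comp_continuous (by fun_prop)
      fun x => mem_Ici.mpr (le_max_left _ _)
  refine ⟨?_, ?_⟩
  · refine (hcont.comp_aestronglyMeasurable hCin.aestronglyMeasurable).congr ?_
    filter_upwards [hCin0] with m hm
    rw [max_eq_right hm]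
  · rw [hasFiniteIntegral_iff_ofReal]
    · exact hfin
    · filter_upwards [hCin0] with m hm using hψ.nonneg _ hm

/-- Jensen's inequality on each cell, since `C_a^0` is a cell average. -/
theorem IsVallee.sum_conc_zero_le (hψ : IsVallee ψ) (M : Mesh R) {K : ℝ → ℝ → ℝ}
    {B : ℝ → ℝ → ℝ → ℝ} {dt : ℝ} (hCin : IntegrableOn Cin (Ioo 0 R))
    (hCin0 : ∀ᵐ m ∂(volume.restrict (Ioo 0 R)), 0 ≤ Cin m)
    (hi : IntegrableOn (fun m => ψ (Cin m)) (Ioo 0 R)) :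
    ∑ a ∈ Finset.range M.cells, M.width a * ψ (M.conc K B Cin dt 0 a)
      ≤ ∫ m in Ioo 0 R, ψ (Cin m) := by
  rw [← M.sum_setIntegral_cell hi]
  refine Finset.sum_le_sum fun a ha => ?_
  have ha := Finset.mem_range.mp ha
  have hw := M.width_pos ha
  have hsub : ∀ {F : ℝ → ℝ}, IntegrableOn F (Ioo 0 R) → IntegrableOn F (M.cell a) := fun hF =>
    (integrableOn_Ioc_iff_integrableOn_Ioo).mpr hF |>.mono_set (M.cell_subset ha)
  have hvol : volume.real (M.cell a) = M.width a :=
    Real.volume_real_Ioc_of_le (M.node_lt a ha).le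
  have h := hψ.convex.map_set_average_le hψ.contDiff.continuousOn isClosed_Ici
    (t := M.cell a) (μ := volume) (f := Cin)
    (fun h0 => by rw [measureReal_def, h0] at hvol; simp at hvol; linarith)
    measure_Ioc_lt_top.ne (M.ae_cell hCin0 ha) (hsub hCin) (hsub hi)
  rw [setAverage_eq, setAverage_eq, hvol, smul_eq_mul, smul_eq_mul, ← one_div] at h
  simp only [Mesh.conc]
  calc _ ≤ M.width a * (1 / M.width a * ∫ m in M.cell a, ψ (Cin m)) :=
        mul_le_mul_of_nonneg_left h hw.le
    _ = _ := by field_simp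

/-- The pointwise bound does not involve time, so it is integrated over whole columns `(0,T) × cell
a`; the values 0 of the approximation obey it too, because `ψ(0) = 0`. -/
theorem IsVallee.lintegral_approx_le (hψ : IsVallee ψ) (M : Mesh R) {K : ℝ → ℝ → ℝ}
    {B : ℝ → ℝ → ℝ → ℝ} {N : ℕ} {G : ℝ} (hT : 0 ≤ T) (hG : 0 ≤ G)
    (hCin : IntegrableOn Cin (Ioo 0 R))
    (hCin0 : ∀ᵐ m ∂(volume.restrict (Ioo 0 R)), 0 ≤ Cin m)
    (hi : IntegrableOn (fun m => ψ (Cin m)) (Ioo 0 R))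
    (hbd : ∀ n ≤ N, ∀ a < M.cells, 0 ≤ M.conc K B Cin (T / N) n a ∧
        M.conc K B Cin (T / N) n a ≤ M.conc K B Cin (T / N) 0 a + G) :
    ∫⁻ p in Ioo 0 T ×ˢ Ioo 0 R, ENNReal.ofReal (ψ (M.approx K B Cin T N p))
      ≤ ENNReal.ofReal (T * (2 * (∫ m in Ioo 0 R, ψ (Cin m)) + 2 * R * ψ G)) := by
  set C₀ := M.conc K B Cin (T / N) 0 with hC₀
  have hC₀0 : ∀ a < M.cells, 0 ≤ C₀ a := fun a ha => (hbd 0 (Nat.zero_le _) a ha).1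
  have hc0 : ∀ a < M.cells, 0 ≤ 2 * ψ (C₀ a) + 2 * ψ G := fun a ha => by
    have h1 := hψ.nonneg _ (hC₀0 a ha)
    have h2 := hψ.nonneg _ hG
    positivity
  have hpt : ∀ a < M.cells, ∀ p : ℝ × ℝ, p.2 ∈ M.cell a →
      ψ (M.approx K B Cin T N p) ≤ 2 * ψ (C₀ a) + 2 * ψ G := by
    intro a ha p hp
    rcases M.approx_eq_zero_or (K := K) (B := B) (Cin := Cin) (N := N) hT p with h | h
    · rw [h, hψ.zero]; exact hc0 a ha
    · obtain ⟨n, hn, a', ha', hp', h⟩ := h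
      obtain rfl := M.eq_of_mem_cell ha ha' hp hp'
      obtain ⟨h1, h2⟩ := hbd n hn.le a ha
      rw [h]
      exact (hψ.monotoneOn h1 (add_nonneg (hC₀0 a ha) hG) h2).trans
        (hψ.apply_add_le (hC₀0 a ha) hG)
  have hsub : Ioo 0 T ×ˢ Ioo 0 R ⊆ ⋃ a ∈ Finset.range M.cells, Ioo 0 T ×ˢ M.cell a := by
    rintro p ⟨hp1, hp2⟩
    obtain ⟨a, ha, hpa⟩ := M.exists_mem_cell (Ioo_subset_Ioc_self hp2)
    exact mem_biUnion (Finset.mem_coe.mpr (Finset.mem_range.mpr ha)) ⟨hp1, hpa⟩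
  have hcell : ∀ a ∈ Finset.range M.cells,
      ∫⁻ p in Ioo 0 T ×ˢ M.cell a, ENNReal.ofReal (ψ (M.approx K B Cin T N p))
        ≤ ENNReal.ofReal (T * (M.width a * (2 * ψ (C₀ a) + 2 * ψ G))) := by
    intro a ha
    have ha := Finset.mem_range.mp ha
    have h1 : ∫⁻ p in Ioo 0 T ×ˢ M.cell a, ENNReal.ofReal (ψ (M.approx K B Cin T N p))
        ≤ ∫⁻ _ in Ioo 0 T ×ˢ M.cell a, ENNReal.ofReal (2 * ψ (C₀ a) + 2 * ψ G) :=
      setLIntegral_mono' (measurableSet_Ioo.prod measurableSet_Ioc) fun p hp =>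
        ENNReal.ofReal_le_ofReal (hpt a ha p hp.2)
    refine h1.trans (le_of_eq ?_)
    rw [setLIntegral_const, Measure.volume_eq_prod, Measure.prod_prod, Real.volume_Ioo, Mesh.cell,
      Real.volume_Ioc, sub_zero, ← ENNReal.ofReal_mul hT, ← ENNReal.ofReal_mul (hc0 a ha),
      Mesh.width]
    congr 1
    ring
  calc ∫⁻ p in Ioo 0 T ×ˢ Ioo 0 R, ENNReal.ofReal (ψ (M.approx K B Cin T N p))
      ≤ ∫⁻ p in ⋃ a ∈ Finset.range M.cells, Ioo 0 T ×ˢ M.cell a,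
          ENNReal.ofReal (ψ (M.approx K B Cin T N p)) := lintegral_mono_set hsub
    _ ≤ ∑ a ∈ Finset.range M.cells, ∫⁻ p in Ioo 0 T ×ˢ M.cell a,
          ENNReal.ofReal (ψ (M.approx K B Cin T N p)) := by
        rw [lintegral_biUnion_finset]
        · intro a ha a' ha' hne
          refine Set.disjoint_left.mpr fun p hp hp' => hne ?_
          exact M.eq_of_mem_cell (Finset.mem_range.mp (Finset.mem_coe.mp ha))
            (Finset.mem_range.mp (Finset.mem_coe.mp ha')) hp.2 hp'.2
        · exact fun a _ => measurableSet_Ioo.prod measurableSet_Ioc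
    _ ≤ ∑ a ∈ Finset.range M.cells,
          ENNReal.ofReal (T * (M.width a * (2 * ψ (C₀ a) + 2 * ψ G))) := Finset.sum_le_sum hcell
    _ = ENNReal.ofReal (∑ a ∈ Finset.range M.cells,
          T * (M.width a * (2 * ψ (C₀ a) + 2 * ψ G))) := by
        rw [ENNReal.ofReal_sum_of_nonneg]
        intro a ha
        have ha := Finset.mem_range.mp ha
        exact mul_nonneg hT (mul_nonneg (M.width_pos ha).le (hc0 a ha))
    _ ≤ _ := by
        refine ENNReal.ofReal_le_ofReal ?_
        have e : ∑ a ∈ Finset.range M.cells, T * (M.width a * (2 * ψ (C₀ a) + 2 * ψ G))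
            = T * (2 * (∑ a ∈ Finset.range M.cells, M.width a * ψ (C₀ a))
              + 2 * (∑ a ∈ Finset.range M.cells, M.width a) * ψ G) := by
          rw [← Finset.mul_sum, mul_assoc 2, Finset.sum_mul, ← mul_add, ← Finset.sum_add_distrib,
            Finset.mul_sum (Finset.range M.cells) _ 2]
          congr 1
          exact Finset.sum_congr rfl fun a _ => by ring
        rw [e, M.sum_width]
        have h := hψ.sum_conc_zero_le M (K := K) (B := B) (dt := T / N) hCin hCin0 hi
        exact mul_le_mul_of_nonneg_left (by linarith) hT

/-- A superlinear bound implies uniform integrability. -/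
theorem IsVallee.exists_integral_sub_min_le (hψ : IsVallee ψ) {X : Type*} [MeasurableSpace X]
    {μ : Measure X} {F : Set (X → ℝ)} (hF : ∀ f ∈ F, Integrable f μ)
    (hF0 : ∀ f ∈ F, ∀ x, 0 ≤ f x) {Q : ℝ≥0}
    (hQ : ∀ f ∈ F, ∫⁻ x, ENNReal.ofReal (ψ (f x)) ∂μ ≤ Q) {ε : ℝ} (hε : 0 < ε) :
    ∃ K₀ : ℕ, ∀ K ≥ K₀, ∀ f ∈ F, ∫ x, (f x - min (f x) (K : ℝ)) ∂μ ≤ ε := by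
  -- Above a threshold, `ψ(ν) ≥ ((Q + 1) / ε) ν`, so the part of `f` above it is at most `ε / (Q +
  -- 1)` times `ψ(f)`. The 1 guards against `Q = 0`.
  have hL : 0 < ((Q : ℝ) + 1) / ε := by positivity
  obtain ⟨ν₀, hν₀⟩ := eventually_atTop.mp (tendsto_atTop.mp hψ.superlinear (((Q : ℝ) + 1) / ε))
  obtain ⟨K₀, hK₀⟩ := exists_nat_ge ν₀
  refine ⟨K₀, fun K hK f hf => ?_⟩
  have hpt : ∀ x, f x - min (f x) (K : ℝ) ≤ ε / (Q + 1) * ψ (f x) := by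
    intro x
    have h0 := hF0 f hf x
    rcases le_or_gt (f x) K with h | h
    · rw [min_eq_left h, sub_self]
      exact mul_nonneg (by positivity) (hψ.nonneg _ h0)
    · have hfx : 0 < f x := (Nat.cast_nonneg K).trans_lt h
      have h1 := hν₀ (f x) (hK₀.trans ((Nat.cast_le.mpr hK).trans h.le))
      rw [le_div_iff₀ hfx] at h1
      have h2 := mul_le_mul_of_nonneg_left h1 (show 0 ≤ ε / ((Q : ℝ) + 1) by positivity)
      have h3 : ε / ((Q : ℝ) + 1) * (((Q : ℝ) + 1) / ε * f x) = f x := by field_simp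
      have h4 : 0 ≤ min (f x) (K : ℝ) := le_min h0 (Nat.cast_nonneg K)
      linarith
  have hnn : ∀ x, 0 ≤ f x - min (f x) (K : ℝ) := fun x => sub_nonneg.mpr (min_le_left _ _)
  rw [integral_eq_lintegral_of_nonneg_ae (Eventually.of_forall hnn)
    ((hF f hf).aestronglyMeasurable.sub
      ((hF f hf).aestronglyMeasurable.inf aestronglyMeasurable_const))]
  refine ENNReal.toReal_le_of_le_ofReal hε.le ?_
  calc ∫⁻ x, ENNReal.ofReal (f x - min (f x) (K : ℝ)) ∂μ
      ≤ ∫⁻ x, ENNReal.ofReal (ε / (Q + 1)) * ENNReal.ofReal (ψ (f x)) ∂μ := by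
        refine lintegral_mono fun x => ?_
        rw [← ENNReal.ofReal_mul (by positivity)]
        exact ENNReal.ofReal_le_ofReal (hpt x)
    _ = ENNReal.ofReal (ε / (Q + 1)) * ∫⁻ x, ENNReal.ofReal (ψ (f x)) ∂μ :=
        lintegral_const_mul' _ _ ENNReal.ofReal_ne_top
    _ ≤ ENNReal.ofReal (ε / (Q + 1)) * ENNReal.ofReal Q := by
        rw [ENNReal.ofReal_coe_nnreal]
        exact mul_le_mul_right (hQ f hf) _
    _ ≤ ENNReal.ofReal ε := by
        rw [← ENNReal.ofReal_mul (by positivity)]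
        refine ENNReal.ofReal_le_ofReal ?_
        rw [div_mul_eq_mul_div, div_le_iff₀ (by positivity)]
        nlinarith [Q.coe_nonneg]

end entropy

end CollisionalBreakage

/-! ### Assembly. -/

theorem mainTheorem3
    (lam α ζ η T R θ : ℝ) (B : ℝ → ℝ → ℝ → ℝ) (Cin : ℝ → ℝ)
    (hlam : 0 < lam) (hα : 0 ≤ α) (hζ : 0 < ζ) (hζη : ζ ≤ η) (hη : η ≤ 1) (hsum : ζ + η ≤ 1)
    (hT : 0 < T) (hR : 0 < R) (hθ0 : 0 < θ) (hθ1 : θ < 1)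
    (hB : CollisionalBreakage.IsBreakageKernel R B)
    (hCin : IntegrableOn Cin (Ioo 0 R))
    (hCin0 : ∀ᵐ m ∂(volume.restrict (Ioo 0 R)), 0 ≤ Cin m) :
    (∃ ψ : ℝ → ℝ, CollisionalBreakage.IsVallee ψ ∧
      ∫⁻ m in Ioo 0 R, ENNReal.ofReal (ψ (Cin m)) < ∞) ∧
    ∃ h₀ : ℝ, 0 < h₀ ∧
      (∀ f ∈ CollisionalBreakage.approxFamily lam α ζ η T R θ h₀ B Cin, ∀ p, 0 ≤ f p) ∧
      (∀ ψ : ℝ → ℝ, CollisionalBreakage.IsVallee ψ →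
        ∫⁻ m in Ioo 0 R, ENNReal.ofReal (ψ (Cin m)) < ∞ →
        ∃ Q : ℝ≥0, ∀ f ∈ CollisionalBreakage.approxFamily lam α ζ η T R θ h₀ B Cin,
          ∫⁻ p in Ioo 0 T ×ˢ Ioo 0 R, ENNReal.ofReal (ψ (f p)) ≤ Q) ∧
      CollisionalBreakage.IsWeaklySeqCompactL1 (volume.restrict (Ioo 0 T ×ˢ Ioo 0 R))
        (CollisionalBreakage.approxFamily lam α ζ η T R θ h₀ B Cin) := by
  obtain ⟨ψ₀, hψ₀, hfin₀⟩ := CollisionalBreakage.exists_isVallee hCin hCin0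
  refine ⟨⟨ψ₀, hψ₀, hfin₀⟩, ?_⟩
  -- Both `h₀` and `G` are fixed before any `ψ` is considered, so one family serves all entropies.
  obtain ⟨h₀, hh₀, G, hG, hbd⟩ := CollisionalBreakage.exists_conc_bounds hlam hT hR hθ1 hB
    (fun u v hu hv => CollisionalBreakage.collisionKernel_nonneg (α := α) (ζ := ζ) (η := η)
      hlam hu hv)
    (fun u v hu hv => CollisionalBreakage.collisionKernel_le hlam hα hζ hζη hsum hu hv)
    hCin hCin0
  have hpos : ∀ f ∈ CollisionalBreakage.approxFamily lam α ζ η T R θ h₀ B Cin, ∀ p, 0 ≤ f p := by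
    rintro f ⟨M, N, hN, hsize, hstab, rfl⟩ p
    rcases M.approx_eq_zero_or (K := CollisionalBreakage.collisionKernel lam α ζ η) (B := B)
      (Cin := Cin) (N := N) hT.le p with h | ⟨n, hn, a, ha, -, h⟩
    · exact h.ge
    · rw [h]; exact (hbd M N hN hsize hstab n hn.le a ha).1
  have hent : ∀ ψ : ℝ → ℝ, CollisionalBreakage.IsVallee ψ →
      ∫⁻ m in Ioo 0 R, ENNReal.ofReal (ψ (Cin m)) < ∞ →
      ∃ Q : ℝ≥0, ∀ f ∈ CollisionalBreakage.approxFamily lam α ζ η T R θ h₀ B Cin,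
        ∫⁻ p in Ioo 0 T ×ˢ Ioo 0 R, ENNReal.ofReal (ψ (f p)) ≤ Q := by
    intro ψ hψ hfin
    refine ⟨Real.toNNReal (T * (2 * (∫ m in Ioo 0 R, ψ (Cin m)) + 2 * R * ψ G)), ?_⟩
    rintro f ⟨M, N, hN, hsize, hstab, rfl⟩
    exact hψ.lintegral_approx_le M hT.le hG hCin hCin0
      (hψ.integrableOn_comp hCin hCin0 hfin) (hbd M N hN hsize hstab)
  have hfinm : IsFiniteMeasure ((volume : Measure (ℝ × ℝ)).restrict (Ioo 0 T ×ˢ Ioo 0 R)) := by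
    refine ⟨?_⟩
    rw [Measure.restrict_apply_univ, Measure.volume_eq_prod, Measure.prod_prod]
    exact ENNReal.mul_lt_top measure_Ioo_lt_top measure_Ioo_lt_top
  have hint : ∀ f ∈ CollisionalBreakage.approxFamily lam α ζ η T R θ h₀ B Cin,
      Integrable f (volume.restrict (Ioo 0 T ×ˢ Ioo 0 R)) := by
    rintro f ⟨M, N, -, -, -, rfl⟩
    exact M.integrable_approx _
  -- A single superlinear entropy suffices for compactness.
  obtain ⟨Q, hQ⟩ := hent ψ₀ hψ₀ hfin₀
  refine ⟨h₀, hh₀, hpos, hent, hint, fun u hu => ?_⟩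
  refine CollisionalBreakage.exists_subseq_weak_L1 u (fun k => hint _ (hu k))
    (fun k => hpos _ (hu k)) fun ε hε => ?_
  obtain ⟨K₀, hK₀⟩ := hψ₀.exists_integral_sub_min_le hint hpos hQ hε
  exact ⟨K₀, fun K hK k => hK₀ K hK _ (hu k)⟩
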